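/- **Mechanisms.** For distributions $P,Q$ on one space and $\alpha\in[0,1]$ let $T(P,Q)(\alpha)=\inf\{1-\mathbb E_Q\varphi:\ \varphi \text{ measurable, } 0\le\varphi\le 1,\ \mathbb E_P\varphi\le\alpha\}$; a function of this form is called a trade-off function. If $f=T(P,Q)$, put $f^{\otimes k}=T(P^{\otimes k},Q^{\otimes k})$ (this does not depend on the choice of $P,Q$). Fix $n,N\ge 1$, $0\le q\le 1$, $\sigma,C>0$, and neighboring datasets $D=\{d_1,\dots,d_N\}$, $D'=D\cup\{d_{N+1}\}$, taken in this order. One round of a mechanism on a dataset $d_1,\dots,d_m$ selects each point independently with probability $q$, which gives a batch $B$, and outputs $$\frac{1}{c}\Big(\sum_{i\in B}\bar g_i+G\Big)\in\mathbb R^n,\qquad \bar g_i=\frac{g_i}{\max(1,\|g_i\|_2/C)},\qquad G\sim\mathcal N(0,\sigma^2C^2\mathbb I_n),$$ with normalization factor $c=mq$ for EASGM, $c=|B|$ for ASGM, $c=\lfloor mq\rfloor$ for FEASGM ($c$ is replaced by $1$ if it is $0$). Here $g_i\in\mathbb R^n$ is the information vector of $d_i$; in a composition it may depend (measurably) on the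 round and on the outputs of the earlier rounds. The transparent mechanism $\mathcal M_I$ outputs in addition the index $I=(B,b)$, where $B\subseteq\{1,\dots,N\}$ contains each point independently with probability $q$ and $b$ is an independent Bernoulli($q$) bit: on $D$ the batch is $B$ (and $b$ is unused), on $D'$ it is $B$ together with $N+1$ if $b=1$. The actual mechanism $\mathcal M$ does not output $I$. $\mathcal M^{\otimes T}$ and $\mathcal M_I^{\otimes T}$ are the (adaptive) $T$-round compositions, with independent randomness across rounds. **Per-round upper bounds.** Let $P=\mathcal N(0,1)$ and $Q_x=\mathcal N\big(0,(\tfrac{x}{x+1})^2\big)$. Put - EASGM, for $q>0$: $\overline f=T(P^{\otimes(n-1)},Q_N^{\otimes(n-1)})$; - ASGM: $\overline f=(q-q(1-q)^N)\,T(P^{\otimes(n-1)},Q_N^{\otimes(n-1)})+(1-q+q(1-q)^N)\,\mathrm{ID}$, where $\mathrm{ID}(\alpha)=1-\alpha$; - FEASGM, if $\lfloor Nq\rfloor=K\ge1$ and $\lfloor(N+1)q\rfloor=K+1$: $\overline f=T(P^{\otimes(n-1)},Q_K^{\otimes(n-1)})$. **Theorem.** For each of the three mechanisms and every integer $T\ge1$,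 $$T\big(\mathcal M^{\otimes T}(D),\mathcal M^{\otimes T}(D')\big)\ \ge\ T\big(\mathcal M_I^{\otimes T}(D),\mathcal M_I^{\otimes T}(D')\big)\quad\text{on }[0,1].$$ Moreover, under the condition listed for the mechanism, $\overline f$ is a trade-off function, $\overline f^{\otimes T}$ is well defined, and $$\overline f^{\otimes T}\ \ge\ T\big(\mathcal M_I^{\otimes T}(D),\mathcal M_I^{\otimes T}(D')\big)\quad\text{on }[0,1].$$ -/

import Mathlib

open MeasureTheory ProbabilityTheory Set
open scoped NNReal ENNReal

noncomputable section

namespace DPSGD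

/-! ### Trade-off functions and their tensor powers -/

/-- The trade-off function `T(P, Q)`: the least type II error `1 - E_Q[φ]` among the (possibly
randomized) rejection rules `φ : Ω → [0, 1]` whose type I error `E_P[φ]` is at most `α`.
It is meaningful for `α ∈ [0, 1]`. -/
def tradeOff {Ω : Type*} [MeasurableSpace Ω] (P Q : Measure Ω) (α : ℝ) : ℝ :=
  sInf {β : ℝ | ∃ φ : Ω → ℝ, Measurable φ ∧ (∀ x, φ x ∈ Icc (0 : ℝ) 1) ∧
    ∫ x, φ x ∂P ≤ α ∧ β = 1 - ∫ x, φ x ∂Q}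

/-- `P, Q` are probability measures whose trade-off function on `[0, 1]` is `f`. -/
def Represents (f : ℝ → ℝ) {Ω : Type} [MeasurableSpace Ω] (P Q : Measure Ω) : Prop :=
  IsProbabilityMeasure P ∧ IsProbabilityMeasure Q ∧ ∀ α ∈ Icc (0 : ℝ) 1, tradeOff P Q α = f α

/-- `f` is a trade-off function: it is the trade-off function of some pair of distributions. -/
def IsTradeOff (f : ℝ → ℝ) : Prop :=
  ∃ (Ω : Type) (_ : MeasurableSpace Ω) (P Q : Measure Ω), Represents f P Q

/-- The tensor power `f^{⊗T}`: the value `T(P^{⊗T}, Q^{⊗T})(α)` for the pairs `P, Q` with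
`f = T(P, Q)`. (It does not depend on the pair, see `TensorPowSpec`; the infimum merely avoids
a choice.) -/
def tensorPow (f : ℝ → ℝ) (T : ℕ) (α : ℝ) : ℝ :=
  sInf {β : ℝ | ∃ (Ω : Type) (_ : MeasurableSpace Ω) (P Q : Measure Ω), Represents f P Q ∧
    β = tradeOff (Measure.pi fun _ : Fin T => P) (Measure.pi fun _ : Fin T => Q) α}

/-- `f^{⊗T}` is well defined: `f` is a trade-off function, and `f^{⊗T} = T(P^{⊗T}, Q^{⊗T})` on
`[0, 1]` for every pair `P, Q` of distributions with `f = T(P, Q)`. -/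
def TensorPowSpec (f : ℝ → ℝ) (T : ℕ) : Prop :=
  IsTradeOff f ∧
    ∀ (Ω : Type) (_ : MeasurableSpace Ω) (P Q : Measure Ω), Represents f P Q →
      ∀ α ∈ Icc (0 : ℝ) 1,
        tradeOff (Measure.pi fun _ : Fin T => P) (Measure.pi fun _ : Fin T => Q) α =
          tensorPow f T α

/-! ### One round of the mechanisms -/

/-- The output space `ℝⁿ` with the Euclidean norm. -/
abbrev E (n : ℕ) : Type := EuclideanSpace ℝ (Fin n)

/-- Clipping to norm at most `C`. -/
def clip {n : ℕ} (C : ℝ) (g : E n) : E n := (max 1 (‖g‖ / C))⁻¹ • g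

/-- The Gaussian noise `N(0, σ² C² I)` on `ℝⁿ`. -/
def noise (n : ℕ) (σ C : ℝ) : Measure (E n) :=
  (Measure.pi fun _ : Fin n => gaussianReal 0 (σ ^ 2 * C ^ 2).toNNReal).map (WithLp.toLp 2)

/-- Poisson subsampling of `m` points: every point is selected (`true`) independently with
probability `q`. -/
def batchLaw (q : ℝ) (m : ℕ) : Measure (Fin m → Bool) :=
  Measure.pi fun _ =>
    ENNReal.ofReal q • Measure.dirac true + ENNReal.ofReal (1 - q) • Measure.dirac false

/-- The number of selected points. -/
def batchSize {m : ℕ} (S : Fin m → Bool) : ℕ := (Finset.univ.filter fun i => S i = true).card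

/-- The three averaged variants of the subsampled Gaussian mechanism: normalization by the
expected batch size, by the realized batch size, by the floor of the expected batch size. -/
inductive Variant
  | EASGM
  | ASGM
  | FEASGM

/-- A vanishing normalization factor is replaced by `1`. -/
def orOne (x : ℝ) : ℝ := open Classical in if x = 0 then 1 else x

/-- The normalization factor for a dataset of size `m` and a batch of size `k`. -/
def Variant.factor (v : Variant) (q : ℝ) (m k : ℕ) : ℝ :=
  match v with
  | .EASGM => orOne (m * q)
  | .ASGM => orOne k
  | .FEASGM => orOne (⌊(m : ℝ) * q⌋₊ : ℝ)

/-- The law of the output `(∑_{i ∈ S} clip(gᵢ) + G) / factor`, given the batch `S`, for a dataset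
with information vectors `g₁, …, g_m`. -/
def outputLaw (v : Variant) {n m : ℕ} (q σ C : ℝ) (g : Fin m → E n) (S : Fin m → Bool) :
    Measure (E n) :=
  (noise n σ C).map fun G =>
    (v.factor q m (batchSize S))⁻¹ •
      ((∑ i ∈ Finset.univ.filter (fun i => S i = true), clip C (g i)) + G)

/-- One round of the actual mechanism: the batch is sampled and not revealed. -/
def hiddenRound (v : Variant) {n m : ℕ} (q σ C : ℝ) (g : Fin m → E n) : Measure (E n) :=
  (batchLaw q m).bind fun S => outputLaw v q σ C g S

/-- One transparent round on the larger dataset `D'` with `N + 1` points: the output together with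
the index `I`. The index tells which of the `N` common points, and whether the extra
point `d_{N+1}`, are selected. -/
def transparentRoundLarge (v : Variant) {n N : ℕ} (q σ C : ℝ) (g : Fin (N + 1) → E n) :
    Measure (E n × (Fin (N + 1) → Bool)) :=
  (batchLaw q (N + 1)).bind fun I => (outputLaw v q σ C g I).map fun y => (y, I)

/-- One transparent round on the smaller dataset `D` with `N` points: the output together with an
index `I` of the same law as for `D'`. The batch consists of the first `N` coordinates of `I`; the
last coordinate (the selection of the extra point, which `D` lacks) is not used. -/
def transparentRoundSmall (v : Variant) {n N : ℕ} (q σ C : ℝ) (g : Fin N → E n) :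
    Measure (E n × (Fin (N + 1) → Bool)) :=
  (batchLaw q (N + 1)).bind fun I =>
    (outputLaw v q σ C g fun i => I i.castSucc).map fun y => (y, I)

/-! ### Composition over `T` rounds -/

/-- The law of the transcript of `T` rounds, where, with fresh randomness, round `t` has law
`step t h` given the transcript `h` of the previous rounds. -/
def compose {Ω : Type*} [MeasurableSpace Ω] (step : (t : ℕ) → (Fin t → Ω) → Measure Ω) :
    (T : ℕ) → Measure (Fin T → Ω)
  | 0 => Measure.dirac Fin.elim0
  | T + 1 => (compose step T).bind fun h =>
      (step T h).map fun y => (Fin.snoc (α := fun _ => Ω) h y : Fin (T + 1) → Ω)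

/-- The information vectors: in round `t`, the vector of the data point `x` may depend on `t` and
on the outputs of the previous rounds. -/
abbrev Info (X : Type*) (n : ℕ) := (t : ℕ) → (Fin t → E n) → X → E n

/-- The `T`-round composition of the actual mechanism on the dataset `D`. -/
def hiddenComp (v : Variant) {X : Type*} {n m : ℕ} (q σ C : ℝ) (g : Info X n) (D : Fin m → X)
    (T : ℕ) : Measure (Fin T → E n) :=
  compose (fun t h => hiddenRound v q σ C fun i => g t h (D i)) T

/-- The `T`-round composition of the transparent mechanism on the larger dataset. -/
def transparentCompLarge (v : Variant) {X : Type*} {n N : ℕ} (q σ C : ℝ) (g : Info X n)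
    (D : Fin (N + 1) → X) (T : ℕ) : Measure (Fin T → E n × (Fin (N + 1) → Bool)) :=
  compose (fun t h => transparentRoundLarge v q σ C fun i => g t (fun s => (h s).1) (D i)) T

/-- The `T`-round composition of the transparent mechanism on the smaller dataset. -/
def transparentCompSmall (v : Variant) {X : Type*} {n N : ℕ} (q σ C : ℝ) (g : Info X n)
    (D : Fin N → X) (T : ℕ) : Measure (Fin T → E n × (Fin (N + 1) → Bool)) :=
  compose (fun t h => transparentRoundSmall v q σ C fun i => g t (fun s => (h s).1) (D i)) T

/-! ### The per-round upper bounds -/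

/-- `T(P^{⊗k}, Q_x^{⊗k})` with `P = N(0, 1)` and `Q_x = N(0, (x / (x + 1))²)`. -/
def gaussTradeOff (k x : ℕ) : ℝ → ℝ :=
  tradeOff (Measure.pi fun _ : Fin k => gaussianReal 0 1)
    (Measure.pi fun _ : Fin k => gaussianReal 0 (((x : ℝ≥0) / ((x : ℝ≥0) + 1)) ^ 2))

/-- The per-round upper bound, in output dimension `n` and for `|D| = N`; for ASGM it is a
pointwise combination with `ID(α) = 1 - α`. -/
def Variant.fbar (v : Variant) (q : ℝ) (N n : ℕ) : ℝ → ℝ :=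
  match v with
  | .EASGM => gaussTradeOff (n - 1) N
  | .ASGM => fun α =>
      (q - q * (1 - q) ^ N) * gaussTradeOff (n - 1) N α +
        (1 - q + q * (1 - q) ^ N) * (1 - α)
  | .FEASGM => gaussTradeOff (n - 1) ⌊(N : ℝ) * q⌋₊

/-- The parameters for which the upper bound is claimed: the nominal factor of EASGM does not
vanish; the factors of FEASGM on the two datasets are `K` and `K + 1` with `K ≥ 1`. -/
def Variant.Regime (v : Variant) (q : ℝ) (N : ℕ) : Prop :=
  match v with
  | .EASGM => 0 < q
  | .ASGM => True
  | .FEASGM => 1 ≤ ⌊(N : ℝ) * q⌋₊ ∧ ⌊((N + 1 : ℕ) : ℝ) * q⌋₊ = ⌊(N : ℝ) * q⌋₊ + 1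

end DPSGD

end

/-! Both inequalities are instances of data processing: a randomized map applied to both hypotheses
can only raise the trade-off function (`tradeOff_le_bind`, `tradeOff_le_map`).

Forgetting the indices is such a map, which gives the first inequality. For the second, a
post-processing is built that turns every transparent round on `D` into a standard Gaussian in
dimension `n - 1`, and every round on `D'` into one fixed law `ρ` whose trade-off function against
that Gaussian is the per-round bound. The post-processing may use the history and the index, hence
knows both means and both normalization factors. Multiplying by the factor for `D`, subtracting the
mean for `D` and dividing by `σ C` produces `N(0, I)` on `D` and `N(d, r² I)` on `D'`, with known
`d` and `r` the ratio of the two factors. A reflection that maps `d` to a multiple of the zeroth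
basis vector, followed by deletion of that coordinate, removes the mean difference; only the
variances `1` and `r²` remain (`output_bind_postMap`, `exists_postKernel`).

For EASGM and FEASGM, `r` is `N / (N + 1)` or `K / (K + 1)` whatever the index. For ASGM it is `j /
(j + 1)` when the extra point is selected with `j ≥ 1` others; adding fresh noise keeps the law for
`D` and raises the variance to that of `Q_N`, since `j ≤ N`. For every other index the output is
replaced by pure noise. Then `ρ` is a mixture of `Q_N^{⊗(n-1)}` and `P^{⊗(n-1)}`, and the trade-off
function of a measure against its own mixture is the stated combination (`tradeOff_mixture`).

As the processed laws do not depend on the history, the processed transcripts are product measures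
even under adaptive composition (`compose_bind_transcriptKernel`). It remains to see that tensor
powers are well defined: a trade-off function and the family of hockey-stick divergences determine
each other, reversing order, and the divergences of a product are averages of divergences of one
factor (`hockeyStick_prod`). -/

noncomputable section

namespace DPSGD

/-! ### Elementary properties of trade-off functions -/

section TradeOff

variable {Ω Ω' Ψ : Type*} [MeasurableSpace Ω] [MeasurableSpace Ω'] [MeasurableSpace Ψ]

/-- A (randomized) rejection rule. -/
def IsTest (φ : Ω → ℝ) : Prop := Measurable φ ∧ ∀ x, φ x ∈ Icc (0 : ℝ) 1

lemma IsTest.integrable {φ : Ω → ℝ} (h : IsTest φ) (P : Measure Ω) [IsFiniteMeasure P] :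
    Integrable φ P :=
  Integrable.of_bound h.1.aestronglyMeasurable 1
    (ae_of_all _ fun x => by
      rw [Real.norm_of_nonneg (h.2 x).1]; exact (h.2 x).2)

lemma IsTest.integral_nonneg {φ : Ω → ℝ} (h : IsTest φ) (P : Measure Ω) : 0 ≤ ∫ x, φ x ∂P :=
  MeasureTheory.integral_nonneg fun x => (h.2 x).1

lemma IsTest.integral_le_one {φ : Ω → ℝ} (h : IsTest φ) (P : Measure Ω)
    [IsProbabilityMeasure P] : ∫ x, φ x ∂P ≤ 1 := by
  calc ∫ x, φ x ∂P ≤ ∫ _, (1 : ℝ) ∂P :=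
        integral_mono (h.integrable P) (integrable_const _) fun x => (h.2 x).2
    _ = 1 := by simp

lemma isTest_const {c : ℝ} (hc : c ∈ Icc (0 : ℝ) 1) : IsTest fun _ : Ω => c :=
  ⟨measurable_const, fun _ => hc⟩

lemma isTest_indicator {s : Set Ω} (hs : MeasurableSet s) :
    IsTest (s.indicator fun _ => (1 : ℝ)) := by
  refine ⟨measurable_const.indicator hs, fun x => ?_⟩
  by_cases hx : x ∈ s <;> simp [hx]

lemma IsTest.convex {φ ψ : Ω → ℝ} (hφ : IsTest φ) (hψ : IsTest ψ) {a b : ℝ} (ha : 0 ≤ a)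
    (hb : 0 ≤ b) (hab : a + b = 1) : IsTest fun x => a * φ x + b * ψ x :=
  ⟨(hφ.1.const_mul a).add (hψ.1.const_mul b),
    fun x => (convex_Icc (0 : ℝ) 1) (hφ.2 x) (hψ.2 x) ha hb hab⟩

lemma IsTest.comp {φ : Ω' → ℝ} (h : IsTest φ) {f : Ω → Ω'} (hf : Measurable f) :
    IsTest fun x => φ (f x) :=
  ⟨h.1.comp hf, fun _ => h.2 _⟩

lemma tradeOff_le (P Q : Measure Ω) [IsProbabilityMeasure Q] {α : ℝ} {φ : Ω → ℝ} (h : IsTest φ)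
    (hα : ∫ x, φ x ∂P ≤ α) : tradeOff P Q α ≤ 1 - ∫ x, φ x ∂Q := by
  refine csInf_le ⟨0, ?_⟩ ⟨φ, h.1, h.2, hα, rfl⟩
  rintro _ ⟨ψ, h1, h2, -, rfl⟩
  have := IsTest.integral_le_one (φ := ψ) ⟨h1, h2⟩ Q
  linarith

lemma le_tradeOff (P Q : Measure Ω) {α c : ℝ} (h0 : 0 ≤ α)
    (h : ∀ φ : Ω → ℝ, IsTest φ → ∫ x, φ x ∂P ≤ α → c ≤ 1 - ∫ x, φ x ∂Q) :
    c ≤ tradeOff P Q α := by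
  refine le_csInf ⟨_, fun _ => 0, measurable_const, fun _ => by simp, by simpa using h0, rfl⟩ ?_
  rintro _ ⟨φ, h1, h2, h3, rfl⟩
  exact h φ ⟨h1, h2⟩ h3

lemma exists_test_lt (P Q : Measure Ω) {α ε : ℝ} (h0 : 0 ≤ α) (hε : 0 < ε) :
    ∃ φ : Ω → ℝ, IsTest φ ∧ ∫ x, φ x ∂P ≤ α ∧ 1 - ∫ x, φ x ∂Q < tradeOff P Q α + ε := by
  by_contra! H
  have := le_tradeOff P Q h0 H
  linarith

lemma tradeOff_nonneg (P Q : Measure Ω) [IsProbabilityMeasure Q] {α : ℝ} (h0 : 0 ≤ α) :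
    0 ≤ tradeOff P Q α :=
  le_tradeOff P Q h0 fun φ h _ => by linarith [h.integral_le_one Q]

lemma tradeOff_one (P Q : Measure Ω) [IsProbabilityMeasure P] [IsProbabilityMeasure Q] :
    tradeOff P Q 1 = 0 := by
  refine le_antisymm ?_ (tradeOff_nonneg P Q zero_le_one)
  have := tradeOff_le P Q (α := 1) (isTest_const (c := 1) (by simp)) (by simp)
  simpa using this

lemma tradeOff_antitone (P Q : Measure Ω) [IsProbabilityMeasure Q] :
    AntitoneOn (tradeOff P Q) (Icc 0 1) := fun _ ha _ _ hab =>
  le_tradeOff P Q ha.1 fun _ h hP => tradeOff_le P Q h (hP.trans hab)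

/-- Randomizing between two nearly optimal tests averages both their sizes and their powers. -/
lemma convexOn_tradeOff (P Q : Measure Ω) [IsProbabilityMeasure P] [IsProbabilityMeasure Q] :
    ConvexOn ℝ (Icc 0 1) (tradeOff P Q) := by
  refine ⟨convex_Icc 0 1, fun x hx y hy a b ha hb hab => ?_⟩
  refine le_of_forall_pos_le_add fun ε hε => ?_
  obtain ⟨φ, h1, h2, h3⟩ := exists_test_lt P Q hx.1 hε
  obtain ⟨ψ, k1, k2, k3⟩ := exists_test_lt P Q hy.1 hε
  have key : ∀ (μ : Measure Ω) [IsProbabilityMeasure μ], ∫ z, (a * φ z + b * ψ z) ∂μ =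
      a * ∫ z, φ z ∂μ + b * ∫ z, ψ z ∂μ := fun μ _ => by
    rw [integral_add ((h1.integrable μ).const_mul a) ((k1.integrable μ).const_mul b),
      integral_const_mul, integral_const_mul]
  have := tradeOff_le P Q (α := a • x + b • y) (h1.convex k1 ha hb hab) (by
    rw [key P]
    exact add_le_add (mul_le_mul_of_nonneg_left h2 ha) (mul_le_mul_of_nonneg_left k2 hb))
  rw [key Q] at this
  refine this.trans ?_
  simp only [smul_eq_mul]
  have e1 := mul_le_mul_of_nonneg_left h3.le ha
  have e2 := mul_le_mul_of_nonneg_left k3.le hb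
  nlinarith

lemma integral_bind_kernel (P : Measure Ω) (κ : Kernel Ω Ω') {φ : Ω' → ℝ}
    (h : Integrable φ (P.bind κ)) : ∫ y, φ y ∂(P.bind κ) = ∫ x, ∫ y, φ y ∂(κ x) ∂P := by
  have := Kernel.integral_comp (κ := Kernel.const Unit P) (η := κ) (a := ()) (f := φ)
    (by simpa [Kernel.comp_apply] using h)
  simpa [Kernel.comp_apply] using this

/-- Data processing for trade-off functions. -/
lemma tradeOff_le_bind (P Q : Measure Ω) [IsProbabilityMeasure P] [IsProbabilityMeasure Q]
    (κ : Kernel Ω Ω') [IsMarkovKernel κ] {α : ℝ} (h0 : 0 ≤ α) :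
    tradeOff P Q α ≤ tradeOff (P.bind κ) (Q.bind κ) α := by
  refine le_tradeOff _ _ h0 fun φ h hα => ?_
  -- Averaging `φ` over the kernel gives a test on the original space with the same size and power.
  have hT : IsTest fun x => ∫ y, φ y ∂(κ x) :=
    ⟨(h.1.stronglyMeasurable.integral_kernel (κ := κ)).measurable,
      fun x => ⟨h.integral_nonneg _, h.integral_le_one _⟩⟩
  rw [integral_bind_kernel _ _ (h.integrable _)] at hα ⊢
  exact tradeOff_le P Q hT hα

lemma tradeOff_le_map (P Q : Measure Ω) [IsProbabilityMeasure Q]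
    {f : Ω → Ω'} (hf : Measurable f) {α : ℝ} (h0 : 0 ≤ α) :
    tradeOff P Q α ≤ tradeOff (P.map f) (Q.map f) α := by
  refine le_tradeOff _ _ h0 fun φ h hα => ?_
  rw [integral_map hf.aemeasurable h.1.aestronglyMeasurable] at hα ⊢
  exact tradeOff_le P Q (h.comp hf) hα

lemma tradeOff_map_equiv (P Q : Measure Ω) [IsProbabilityMeasure Q] (e : Ω ≃ᵐ Ω')
    {α : ℝ} (h0 : 0 ≤ α) : tradeOff (P.map e) (Q.map e) α = tradeOff P Q α := by
  have : IsProbabilityMeasure (Q.map e) := Measure.isProbabilityMeasure_map e.measurable.aemeasurable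
  refine le_antisymm ?_ (tradeOff_le_map P Q e.measurable h0)
  have := tradeOff_le_map (P.map e) (Q.map e) e.symm.measurable h0
  simpa using this

/-- A rejection rule can be enlarged to have size exactly `α`. -/
lemma IsTest.exists_integral_eq {φ : Ω → ℝ} (h : IsTest φ) (P Q : Measure Ω)
    [IsProbabilityMeasure P] [IsProbabilityMeasure Q] {α : ℝ} (h1 : α ≤ 1)
    (hα : ∫ x, φ x ∂P ≤ α) :
    ∃ ψ : Ω → ℝ, IsTest ψ ∧ ∫ x, ψ x ∂P = α ∧ ∫ x, φ x ∂Q ≤ ∫ x, ψ x ∂Q := by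
  rcases eq_or_lt_of_le (h.integral_le_one P) with h2 | h2
  · exact ⟨φ, h, by linarith, le_rfl⟩
  set u := ∫ x, φ x ∂P with hu
  -- The weight `t` solves `(1 - t) u + t = α`: mix with the test that always rejects.
  set t := (α - u) / (1 - u) with ht
  have ht0 : 0 ≤ t := div_nonneg (by linarith) (by linarith)
  have ht1 : t ≤ 1 := (div_le_one (by linarith)).2 (by linarith)
  have key : ∀ (μ : Measure Ω) [IsProbabilityMeasure μ], ∫ z, ((1 - t) * φ z + t * 1) ∂μ =
      (1 - t) * ∫ z, φ z ∂μ + t := fun μ _ => by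
    rw [integral_add ((h.integrable μ).const_mul _) (integrable_const _), integral_const_mul]
    simp
  refine ⟨fun x => (1 - t) * φ x + t * 1,
    h.convex (isTest_const (by simp)) (by linarith) ht0 (by ring), ?_, ?_⟩
  · rw [key, ← hu]
    have : t * (1 - u) = α - u := div_mul_cancel₀ _ (by linarith)
    linarith
  · rw [key]
    nlinarith [h.integral_le_one Q]

/-- The trade-off function of `P` against a mixture of `Q` and `P`. -/
lemma tradeOff_mixture (P Q M : Measure Ω) [IsProbabilityMeasure P] [IsProbabilityMeasure Q]
    [IsProbabilityMeasure M] {w : ℝ} (hw0 : 0 ≤ w) (hw1 : w ≤ 1)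
    (hR : M = ENNReal.ofReal w • Q + ENNReal.ofReal (1 - w) • P) {α : ℝ} (hα : α ∈ Icc (0 : ℝ) 1) :
    tradeOff P M α = w * tradeOff P Q α + (1 - w) * (1 - α) := by
  have key : ∀ φ : Ω → ℝ, IsTest φ →
      (∫ x, φ x ∂M) = w * ∫ x, φ x ∂Q + (1 - w) * ∫ x, φ x ∂P := fun φ h => by
    rw [hR, integral_add_measure ((h.integrable Q).smul_measure ENNReal.ofReal_ne_top)
      ((h.integrable P).smul_measure ENNReal.ofReal_ne_top), integral_smul_measure,
      integral_smul_measure, ENNReal.toReal_ofReal hw0, ENNReal.toReal_ofReal (by linarith)]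
    rfl
  apply le_antisymm
  · refine le_of_forall_pos_le_add fun ε hε => ?_
    obtain ⟨φ, h1, h2, h3⟩ := exists_test_lt P Q hα.1 hε
    -- Size exactly `α` is needed so that the `P` part of the mixture contributes exactly `1 - α`.
    obtain ⟨ψ, k1, k2, k3⟩ := h1.exists_integral_eq P Q hα.2 h2
    have := tradeOff_le P M k1 k2.le
    rw [key ψ k1, k2] at this
    nlinarith [mul_le_mul_of_nonneg_left (show 1 - ∫ x, ψ x ∂Q ≤ tradeOff P Q α + ε by linarith) hw0]
  · refine le_tradeOff P M hα.1 fun φ h hP => ?_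
    rw [key φ h]
    nlinarith [mul_le_mul_of_nonneg_left (tradeOff_le P Q h hP) hw0,
      mul_le_mul_of_nonneg_left hP (show 0 ≤ 1 - w by linarith)]

end TradeOff

/-! ### Hockey-stick divergences, and the comparison of products -/

section HockeyStick

variable {Ω Ω' Ψ : Type*} [MeasurableSpace Ω] [MeasurableSpace Ω'] [MeasurableSpace Ψ]

/-- `p` and `q` are densities of `P` and `Q` with respect to `μ`. -/
structure HasDensities (P Q μ : Measure Ω) (p q : Ω → ℝ≥0) : Prop where
  measurable_left : Measurable p
  measurable_right : Measurable q
  left_eq : P = μ.withDensity fun x => (p x : ℝ≥0∞)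
  right_eq : Q = μ.withDensity fun x => (q x : ℝ≥0∞)

lemma exists_density {P μ : Measure Ω} [IsFiniteMeasure P] [IsFiniteMeasure μ] (h : P ≪ μ) :
    ∃ p : Ω → ℝ≥0, Measurable p ∧ P = μ.withDensity fun x => (p x : ℝ≥0∞) := by
  refine ⟨fun x => (P.rnDeriv μ x).toNNReal, (P.measurable_rnDeriv μ).ennreal_toNNReal, ?_⟩
  conv_lhs => rw [← Measure.withDensity_rnDeriv_eq P μ h]
  refine withDensity_congr_ae ?_
  filter_upwards [P.rnDeriv_lt_top μ] with x hx
  exact (ENNReal.coe_toNNReal hx.ne).symm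

lemma exists_hasDensities (P Q : Measure Ω) [IsFiniteMeasure P] [IsFiniteMeasure Q] :
    ∃ p q : Ω → ℝ≥0, HasDensities P Q (P + Q) p q := by
  obtain ⟨p, hp, hp'⟩ := exists_density (P := P) (μ := P + Q)
    (Measure.absolutelyContinuous_of_le (Measure.le_add_right le_rfl))
  obtain ⟨q, hq, hq'⟩ := exists_density (P := Q) (μ := P + Q)
    (Measure.absolutelyContinuous_of_le (Measure.le_add_left le_rfl))
  exact ⟨p, q, hp, hq, hp', hq'⟩

/-- The hockey-stick divergence `∫ (a q - b p)⁺ dμ`. -/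
def hockeyStick (μ : Measure Ω) (p q : Ω → ℝ≥0) (a b : ℝ) : ℝ :=
  ∫ x, max (a * q x - b * p x) 0 ∂μ

variable {P Q μ : Measure Ω} {p q : Ω → ℝ≥0} {P' Q' μ' : Measure Ω'} {p' q' : Ω' → ℝ≥0}
  {R S ν : Measure Ψ} {r s : Ψ → ℝ≥0}

lemma integrable_density [IsFiniteMeasure P] (hp : Measurable p)
    (h : P = μ.withDensity fun x => (p x : ℝ≥0∞)) : Integrable (fun x => (p x : ℝ)) μ := by
  have : Integrable (fun _ : Ω => (1 : ℝ)) (μ.withDensity fun x => (p x : ℝ≥0∞)) := by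
    rw [← h]; exact integrable_const _
  rw [integrable_withDensity_iff_integrable_smul hp] at this
  simpa [NNReal.smul_def] using this

lemma integral_density (hp : Measurable p)
    (h : P = μ.withDensity fun x => (p x : ℝ≥0∞)) (φ : Ω → ℝ) :
    ∫ x, φ x ∂P = ∫ x, p x * φ x ∂μ := by
  rw [h, integral_withDensity_eq_integral_smul hp]
  rfl

lemma IsTest.integrable_mul {φ : Ω → ℝ} (hφ : IsTest φ) {f : Ω → ℝ} (hf : Integrable f μ) :
    Integrable (fun x => f x * φ x) μ :=
  hf.mul_bdd (c := 1) hφ.1.aestronglyMeasurable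
    (ae_of_all _ fun x => by rw [Real.norm_of_nonneg (hφ.2 x).1]; exact (hφ.2 x).2)

namespace HasDensities

lemma integrable_left [IsFiniteMeasure P] (h : HasDensities P Q μ p q) :
    Integrable (fun x => (p x : ℝ)) μ :=
  integrable_density h.measurable_left h.left_eq

lemma integrable_right [IsFiniteMeasure Q] (h : HasDensities P Q μ p q) :
    Integrable (fun x => (q x : ℝ)) μ :=
  integrable_density h.measurable_right h.right_eq

lemma integrable_sub [IsFiniteMeasure P] [IsFiniteMeasure Q] (h : HasDensities P Q μ p q)
    (a b : ℝ) : Integrable (fun x => a * q x - b * p x) μ :=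
  (h.integrable_right.const_mul a).sub (h.integrable_left.const_mul b)

lemma integrable_max [IsFiniteMeasure P] [IsFiniteMeasure Q] (h : HasDensities P Q μ p q)
    (a b : ℝ) : Integrable (fun x => max (a * q x - b * p x) 0) μ :=
  (h.integrable_sub a b).pos_part

lemma sub_eq_integral [IsFiniteMeasure P] [IsFiniteMeasure Q] (h : HasDensities P Q μ p q)
    {φ : Ω → ℝ} (hφ : IsTest φ) (a b : ℝ) :
    a * ∫ x, φ x ∂Q - b * ∫ x, φ x ∂P = ∫ x, (a * q x - b * p x) * φ x ∂μ := by
  rw [integral_density h.measurable_left h.left_eq, integral_density h.measurable_right h.right_eq,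
    ← integral_const_mul, ← integral_const_mul, ← integral_sub
      ((hφ.integrable_mul h.integrable_right).const_mul a)
      ((hφ.integrable_mul h.integrable_left).const_mul b)]
  congr 1
  ext x
  ring

/-- With `exists_test_eq_hockeyStick` this is the Neyman–Pearson principle: the linear functional of
size and power is maximized by rejecting where its integrand is nonnegative. -/
lemma sub_le_hockeyStick [IsFiniteMeasure P] [IsFiniteMeasure Q] (h : HasDensities P Q μ p q)
    {φ : Ω → ℝ} (hφ : IsTest φ) (a b : ℝ) :
    a * ∫ x, φ x ∂Q - b * ∫ x, φ x ∂P ≤ hockeyStick μ p q a b := by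
  rw [h.sub_eq_integral hφ]
  refine integral_mono (hφ.integrable_mul (h.integrable_sub a b)) (h.integrable_max a b)
    fun x => ?_
  obtain ⟨h0, h1⟩ := hφ.2 x
  rcases le_total 0 (a * q x - b * p x : ℝ) with h2 | h2
  · exact le_max_of_le_left (mul_le_of_le_one_right h2 h1)
  · exact le_max_of_le_right (mul_nonpos_of_nonpos_of_nonneg h2 h0)

lemma exists_test_eq_hockeyStick [IsFiniteMeasure P] [IsFiniteMeasure Q]
    (h : HasDensities P Q μ p q) (a b : ℝ) :
    ∃ φ : Ω → ℝ, IsTest φ ∧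
      a * ∫ x, φ x ∂Q - b * ∫ x, φ x ∂P = hockeyStick μ p q a b := by
  have hm : Measurable fun x => (a * q x - b * p x : ℝ) :=
    (h.measurable_right.coe_nnreal_real.const_mul a).sub
      (h.measurable_left.coe_nnreal_real.const_mul b)
  have hs : MeasurableSet {x | 0 ≤ (a * q x - b * p x : ℝ)} := measurableSet_le measurable_const hm
  refine ⟨_, isTest_indicator hs, ?_⟩
  rw [h.sub_eq_integral (isTest_indicator hs)]
  refine integral_congr_ae (ae_of_all _ fun x => ?_)
  by_cases hx : 0 ≤ (a * q x - b * p x : ℝ)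
  · simp only [indicator, mem_ofPred_eq, hx, if_true, mul_one, max_eq_left]
  · simp only [indicator, mem_ofPred_eq, hx, if_false, mul_zero]
    rw [max_eq_right (not_le.1 hx).le]

lemma prod [SFinite μ] [SFinite ν] (h : HasDensities P Q μ p q) (k : HasDensities R S ν r s) :
    HasDensities (P.prod R) (Q.prod S) (μ.prod ν) (fun z => p z.1 * r z.2)
      (fun z => q z.1 * s z.2) where
  measurable_left := (h.measurable_left.comp measurable_fst).mul
    (k.measurable_left.comp measurable_snd)
  measurable_right := (h.measurable_right.comp measurable_fst).mul
    (k.measurable_right.comp measurable_snd)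
  left_eq := by
    rw [h.left_eq, k.left_eq, prod_withDensity h.measurable_left.coe_nnreal_ennreal
      k.measurable_left.coe_nnreal_ennreal]
    simp
  right_eq := by
    rw [h.right_eq, k.right_eq, prod_withDensity h.measurable_right.coe_nnreal_ennreal
      k.measurable_right.coe_nnreal_ennreal]
    simp

end HasDensities

/-- Fubini: on the slice at `y`, the second factor only rescales the two coefficients. For this
reason `hockeyStick` carries both `a` and `b`. -/
lemma hockeyStick_prod [IsFiniteMeasure P] [IsFiniteMeasure Q] [IsFiniteMeasure R]
    [IsFiniteMeasure S] [SFinite μ] [SFinite ν] (h : HasDensities P Q μ p q)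
    (k : HasDensities R S ν r s) (a b : ℝ) :
    Integrable (fun y => hockeyStick μ p q (a * s y) (b * r y)) ν ∧
    hockeyStick (μ.prod ν) (fun z => p z.1 * r z.2) (fun z => q z.1 * s z.2) a b =
      ∫ y, hockeyStick μ p q (a * s y) (b * r y) ∂ν := by
  have hi := (h.prod k).integrable_max a b
  have e : ∀ y, hockeyStick μ p q (a * s y) (b * r y) =
      ∫ x, max (a * ((q x * s y : ℝ≥0) : ℝ) - b * ((p x * r y : ℝ≥0) : ℝ)) 0 ∂μ := fun y => by
    refine integral_congr_ae (ae_of_all _ fun x => ?_)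
    simp only [NNReal.coe_mul]
    congr 1
    ring
  simp_rw [e]
  exact ⟨hi.integral_prod_right, integral_prod_symm _ hi⟩

/-- The optimal test for `P, Q` is matched by a test for `P', Q'` of no larger size and, up to `ε`,
no smaller power. -/
lemma hockeyStick_le_of_tradeOff_le [IsProbabilityMeasure P] [IsProbabilityMeasure Q]
    [IsProbabilityMeasure P'] [IsProbabilityMeasure Q'] (h : HasDensities P Q μ p q)
    (h' : HasDensities P' Q' μ' p' q')
    (hle : ∀ α ∈ Icc (0 : ℝ) 1, tradeOff P' Q' α ≤ tradeOff P Q α) {a b : ℝ} (ha : 0 ≤ a)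
    (hb : 0 ≤ b) : hockeyStick μ p q a b ≤ hockeyStick μ' p' q' a b := by
  obtain ⟨φ, hφ, e⟩ := h.exists_test_eq_hockeyStick a b
  rw [← e]
  refine le_of_forall_pos_le_add fun ε hε => ?_
  -- Division by `a + 1` and not by `a`, since `a` vanishes on slices where the other density does.
  have hd : 0 < ε / (a + 1) := by positivity
  obtain ⟨ψ, hψ, k1, k2⟩ := exists_test_lt P' Q' (hφ.integral_nonneg P) hd
  have k3 := tradeOff_le P Q hφ le_rfl
  have k4 := hle _ ⟨hφ.integral_nonneg P, hφ.integral_le_one P⟩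
  have k5 := h'.sub_le_hockeyStick hψ a b
  have k6 : a * ∫ x, φ x ∂Q ≤ a * (∫ x, ψ x ∂Q' + ε / (a + 1)) :=
    mul_le_mul_of_nonneg_left (by linarith) ha
  have k7 : a * (ε / (a + 1)) ≤ ε := by
    rw [mul_div_assoc', div_le_iff₀ (by positivity)]
    nlinarith
  have k8 := mul_le_mul_of_nonneg_left k1 hb
  linarith

/-- A supporting line of a convex antitone function. -/
lemma exists_supporting_slope {f : ℝ → ℝ} (hf : ConvexOn ℝ (Icc 0 1) f)
    (hanti : AntitoneOn f (Icc 0 1)) {α : ℝ} (h0 : 0 < α) (h1 : α < 1) :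
    ∃ c : ℝ, 0 ≤ c ∧ ∀ β ∈ Icc (0 : ℝ) 1, f α - c * (β - α) ≤ f β := by
  have hα : α ∈ interior (Icc (0 : ℝ) 1) := by simp [h0, h1]
  have hα' : α ∈ Icc (0 : ℝ) 1 := ⟨h0.le, h1.le⟩
  set d := derivWithin f (Ioi α) α
  have hd : d ≤ slope f α 1 :=
    hf.rightDeriv_le_slope_of_mem_interior hα (by simp) h1
  refine ⟨-d, ?_, fun β hβ => ?_⟩
  · have : slope f α 1 ≤ 0 := by
      rw [slope_def_field]
      exact div_nonpos_of_nonpos_of_nonneg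
        (sub_nonpos.2 (hanti hα' (by simp) h1.le)) (by linarith)
    linarith
  · rcases lt_trichotomy β α with hlt | rfl | hlt
    · have k1 := hf.slope_le_leftDeriv_of_mem_interior hβ hα hlt
      have k2 := k1.trans (hf.leftDeriv_le_rightDeriv_of_mem_interior hα)
      rw [slope_def_field, div_le_iff₀ (by linarith)] at k2
      change f α - f β ≤ d * (α - β) at k2
      linarith
    · simp
    · have k1 := hf.rightDeriv_le_slope_of_mem_interior hα hβ hlt
      rw [slope_def_field, le_div_iff₀ (by linarith)] at k1
      change d * (β - α) ≤ f β - f α at k1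
      linarith

/-- Needed at size `0`, where the trade-off function may have no supporting line of finite slope.
The limit is the mass that `Q` gives to the zero set of `p`, the power of the test rejecting there.
-/
lemma tendsto_hockeyStick_one [IsFiniteMeasure P] [IsFiniteMeasure Q]
    (h : HasDensities P Q μ p q) :
    Filter.Tendsto (fun n : ℕ => hockeyStick μ p q 1 n) Filter.atTop
      (nhds (∫ x, {x | p x = 0}.indicator (fun _ => (1 : ℝ)) x ∂Q)) := by
  rw [integral_density h.measurable_right h.right_eq]
  refine tendsto_integral_of_dominated_convergence (fun x => (q x : ℝ))
    (fun n => (h.integrable_max 1 n).aestronglyMeasurable) h.integrable_right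
    (fun n => ae_of_all _ fun x => ?_) (ae_of_all _ fun x => ?_)
  · rw [Real.norm_of_nonneg (le_max_right _ _)]
    refine max_le ?_ (q x).2
    have : 0 ≤ (n : ℝ) * p x := by positivity
    linarith
  · by_cases hx : p x = 0
    · simp [hx]
    · simp only [indicator, mem_ofPred_eq, hx, if_false, mul_zero]
      have hpos : (0 : ℝ) < p x := by positivity
      obtain ⟨m, hm⟩ := exists_nat_ge ((q x : ℝ) / p x)
      refine tendsto_const_nhds.congr' ?_
      filter_upwards [Filter.eventually_ge_atTop m] with n hn
      rw [max_eq_right]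
      have : (m : ℝ) ≤ n := by exact_mod_cast hn
      have := (div_le_iff₀ hpos).1 (hm.trans this)
      linarith

/-- Convex duality: at an interior size, a supporting line of slope `-c` turns the comparison into
one of the divergences with coefficients `1, c`. The endpoints are treated apart. -/
lemma tradeOff_le_of_hockeyStick_le [IsProbabilityMeasure P] [IsProbabilityMeasure Q]
    [IsProbabilityMeasure P'] [IsProbabilityMeasure Q'] (h : HasDensities P Q μ p q)
    (h' : HasDensities P' Q' μ' p' q')
    (hle : ∀ b : ℝ, 0 ≤ b → hockeyStick μ p q 1 b ≤ hockeyStick μ' p' q' 1 b)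
    {α : ℝ} (hα : α ∈ Icc (0 : ℝ) 1) : tradeOff P' Q' α ≤ tradeOff P Q α := by
  refine le_tradeOff P Q hα.1 fun φ hφ hP => ?_
  rcases hα.1.eq_or_lt with rfl | h0
  · have hs : MeasurableSet {x | p' x = 0} := h'.measurable_left (measurableSet_singleton 0)
    have e : ∫ x, {x | p' x = 0}.indicator (fun _ => (1 : ℝ)) x ∂P' = 0 := by
      rw [integral_density h'.measurable_left h'.left_eq]
      refine integral_eq_zero_of_ae (ae_of_all _ fun x => ?_)
      by_cases hx : p' x = 0 <;> simp [hx]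
    refine (tradeOff_le P' Q' (isTest_indicator hs) e.le).trans ?_
    have : ∫ x, φ x ∂Q ≤ ∫ x, {x | p' x = 0}.indicator (fun _ => (1 : ℝ)) x ∂Q' := by
      refine ge_of_tendsto' (tendsto_hockeyStick_one h') fun n => ?_
      refine le_trans ?_ (hle n n.cast_nonneg)
      have k := h.sub_le_hockeyStick hφ 1 n
      rw [le_antisymm hP (hφ.integral_nonneg P)] at k
      simpa using k
    linarith
  · rcases hα.2.eq_or_lt with rfl | h1
    · rw [tradeOff_one]
      linarith [hφ.integral_le_one Q]
    · obtain ⟨c, hc, hsup⟩ := exists_supporting_slope (convexOn_tradeOff P' Q')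
        (tradeOff_antitone P' Q') h0 h1
      obtain ⟨ψ, hψ, e⟩ := h'.exists_test_eq_hockeyStick 1 c
      have k1 := hsup _ ⟨hψ.integral_nonneg P', hψ.integral_le_one P'⟩
      have k2 := tradeOff_le P' Q' hψ le_rfl
      have k3 := (h.sub_le_hockeyStick hφ 1 c).trans (hle c hc)
      have k4 := mul_le_mul_of_nonneg_left hP hc
      linarith

end HockeyStick

/-! ### Tensor powers depend only on the trade-off function -/

section Products

variable {Ω Ω' Ψ : Type*} [MeasurableSpace Ω] [MeasurableSpace Ω'] [MeasurableSpace Ψ]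

lemma tradeOff_prod_mono (P Q : Measure Ω) (P' Q' : Measure Ω') (M S : Measure Ψ)
    [IsProbabilityMeasure P] [IsProbabilityMeasure Q] [IsProbabilityMeasure P']
    [IsProbabilityMeasure Q'] [IsProbabilityMeasure M] [IsProbabilityMeasure S]
    (hle : ∀ α ∈ Icc (0 : ℝ) 1, tradeOff P' Q' α ≤ tradeOff P Q α) :
    ∀ α ∈ Icc (0 : ℝ) 1, tradeOff (P'.prod M) (Q'.prod S) α ≤ tradeOff (P.prod M) (Q.prod S) α := by
  intro α hα
  obtain ⟨p, q, h⟩ := exists_hasDensities P Q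
  obtain ⟨p', q', h'⟩ := exists_hasDensities P' Q'
  obtain ⟨r, s, k⟩ := exists_hasDensities M S
  refine tradeOff_le_of_hockeyStick_le (h.prod k) (h'.prod k) (fun b hb => ?_) hα
  obtain ⟨i1, e1⟩ := hockeyStick_prod h k 1 b
  obtain ⟨i2, e2⟩ := hockeyStick_prod h' k 1 b
  rw [e1, e2]
  exact integral_mono i1 i2 fun y =>
    hockeyStick_le_of_tradeOff_le h h' hle (by positivity) (by positivity)

lemma tradeOff_prod_swap (P Q : Measure Ω) (M S : Measure Ψ) [IsProbabilityMeasure P]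
    [IsProbabilityMeasure Q] [IsProbabilityMeasure M] [IsProbabilityMeasure S] {α : ℝ}
    (h0 : 0 ≤ α) : tradeOff (P.prod M) (Q.prod S) α = tradeOff (M.prod P) (S.prod Q) α := by
  rw [← tradeOff_map_equiv (P.prod M) (Q.prod S) MeasurableEquiv.prodComm h0]
  congr 1
  · exact Measure.prod_swap
  · exact Measure.prod_swap

lemma tradeOff_pi_succ (P Q : Measure Ω) [IsProbabilityMeasure P] [IsProbabilityMeasure Q]
    (T : ℕ) {α : ℝ} (h0 : 0 ≤ α) :
    tradeOff (Measure.pi fun _ : Fin (T + 1) => P) (Measure.pi fun _ : Fin (T + 1) => Q) α =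
      tradeOff (P.prod (Measure.pi fun _ : Fin T => P))
        (Q.prod (Measure.pi fun _ : Fin T => Q)) α := by
  rw [← tradeOff_map_equiv _ _ (MeasurableEquiv.piFinSuccAbove (fun _ : Fin (T + 1) => Ω) 0) h0]
  rw [(measurePreserving_piFinSuccAbove (fun _ : Fin (T + 1) => P) 0).map_eq,
    (measurePreserving_piFinSuccAbove (fun _ : Fin (T + 1) => Q) 0).map_eq]

lemma tradeOff_pi_mono (P Q : Measure Ω) (P' Q' : Measure Ω')
    [IsProbabilityMeasure P] [IsProbabilityMeasure Q] [IsProbabilityMeasure P']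
    [IsProbabilityMeasure Q']
    (hle : ∀ α ∈ Icc (0 : ℝ) 1, tradeOff P' Q' α ≤ tradeOff P Q α) (T : ℕ) :
    ∀ α ∈ Icc (0 : ℝ) 1,
      tradeOff (Measure.pi fun _ : Fin T => P') (Measure.pi fun _ : Fin T => Q') α ≤
        tradeOff (Measure.pi fun _ : Fin T => P) (Measure.pi fun _ : Fin T => Q) α := by
  induction T with
  | zero =>
    intro α hα
    refine le_tradeOff _ _ hα.1 fun φ hφ hP => ?_
    -- The empty product is a single point, so every test is constant.
    have e : φ = fun _ => φ isEmptyElim := funext fun x => congrArg φ (Subsingleton.elim _ _)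
    rw [e] at hP ⊢
    have := tradeOff_le (Measure.pi fun _ : Fin 0 => P') (Measure.pi fun _ : Fin 0 => Q') (α := α)
      (isTest_const (hφ.2 isEmptyElim)) (by simpa using hP)
    simpa using this
  | succ T ih =>
    intro α hα
    rw [tradeOff_pi_succ P Q T hα.1, tradeOff_pi_succ P' Q' T hα.1]
    refine (tradeOff_prod_mono P Q P' Q' _ _ hle α hα).trans ?_
    -- `tradeOff_prod_mono` changes the first factor only; the swap moves the remaining `T`
    -- coordinates there.
    rw [tradeOff_prod_swap P Q _ _ hα.1, tradeOff_prod_swap P Q _ _ hα.1]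
    exact tradeOff_prod_mono _ _ _ _ _ _ ih α hα

end Products

/-- Applying `tradeOff_pi_mono` in both directions shows that the set in the definition of
`tensorPow` is a singleton. -/
lemma tensorPow_eq {f : ℝ → ℝ} {Ω : Type} [MeasurableSpace Ω] {P Q : Measure Ω}
    (h : Represents f P Q) (T : ℕ) {α : ℝ} (hα : α ∈ Icc (0 : ℝ) 1) :
    tradeOff (Measure.pi fun _ : Fin T => P) (Measure.pi fun _ : Fin T => Q) α =
      tensorPow f T α := by
  obtain ⟨hP, hQ, hf⟩ := h
  have : {β : ℝ | ∃ (Ω : Type) (_ : MeasurableSpace Ω) (P Q : Measure Ω), Represents f P Q ∧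
      β = tradeOff (Measure.pi fun _ : Fin T => P) (Measure.pi fun _ : Fin T => Q) α} =
      {tradeOff (Measure.pi fun _ : Fin T => P) (Measure.pi fun _ : Fin T => Q) α} := by
    ext β
    constructor
    · rintro ⟨Ω', _, P', Q', ⟨hP', hQ', hf'⟩, rfl⟩
      refine le_antisymm (tradeOff_pi_mono P Q P' Q' (fun β hβ => ?_) T α hα)
        (tradeOff_pi_mono P' Q' P Q (fun β hβ => ?_) T α hα)
      · rw [hf β hβ, hf' β hβ]
      · rw [hf β hβ, hf' β hβ]
    · rintro rfl
      exact ⟨Ω, _, P, Q, ⟨hP, hQ, hf⟩, rfl⟩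
  rw [tensorPow, this, csInf_singleton]

lemma tensorPowSpec_of_represents {f : ℝ → ℝ} {Ω : Type} [MeasurableSpace Ω] {P Q : Measure Ω}
    (h : Represents f P Q) (T : ℕ) : TensorPowSpec f T :=
  ⟨⟨Ω, _, P, Q, h⟩, fun _ _ _ _ h' _ hα => tensorPow_eq h' T hα⟩

/-! ### Adaptive composition and post-processing -/

section Compose

variable {A B Γ Ω Ω' : Type*} [MeasurableSpace A] [MeasurableSpace B] [MeasurableSpace Γ]
  [MeasurableSpace Ω] [MeasurableSpace Ω']

lemma measurable_map_kernel (κ : Kernel A B) [IsSFiniteKernel κ] {F : A × B → Γ}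
    (hF : Measurable F) : Measurable fun a => (κ a).map fun b => F (a, b) := by
  have h := ((Kernel.id ×ₖ κ).map F).measurable
  have e : ⇑((Kernel.id ×ₖ κ).map F) = fun a => (κ a).map fun b => F (a, b) := by
    ext1 a
    rw [Kernel.map_apply _ hF, Kernel.prod_apply, Kernel.id_apply, Measure.dirac_prod,
      Measure.map_map hF measurable_prodMk_left]
    rfl
  rwa [e] at h

lemma measurable_snoc (T : ℕ) : Measurable fun p : (Fin T → Ω) × Ω =>
    (Fin.snoc (α := fun _ => Ω) p.1 p.2 : Fin (T + 1) → Ω) := by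
  refine measurable_pi_iff.2 fun i => ?_
  refine Fin.lastCases ?_ (fun j => ?_) i
  · simpa using measurable_snd
  · simpa [Function.comp_def] using (measurable_pi_apply j).comp measurable_fst

lemma measurable_snoc_left (T : ℕ) (h : Fin T → Ω) : Measurable fun y : Ω =>
    (Fin.snoc (α := fun _ => Ω) h y : Fin (T + 1) → Ω) :=
  (measurable_snoc T).comp measurable_prodMk_left

lemma measurable_init (T : ℕ) : Measurable fun h : Fin (T + 1) → Ω => fun i : Fin T =>
    h i.castSucc :=
  measurable_pi_iff.2 fun i => measurable_pi_apply i.castSucc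

/-- A family of Markov kernels, one for each round. -/
structure IsMarkovStep (step : (t : ℕ) → (Fin t → Ω) → Measure Ω) : Prop where
  measurable : ∀ t, Measurable (step t)
  isProbabilityMeasure : ∀ t h, IsProbabilityMeasure (step t h)

namespace IsMarkovStep

variable {step : (t : ℕ) → (Fin t → Ω) → Measure Ω}

/-- One round as a kernel. -/
def kernel (hs : IsMarkovStep step) (t : ℕ) : Kernel (Fin t → Ω) Ω := ⟨step t, hs.measurable t⟩

instance (hs : IsMarkovStep step) (t : ℕ) : IsMarkovKernel (hs.kernel t) :=
  ⟨hs.isProbabilityMeasure t⟩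

lemma measurable_map_snoc (hs : IsMarkovStep step) (T : ℕ) : Measurable fun h : Fin T → Ω =>
    (step T h).map fun y => (Fin.snoc (α := fun _ => Ω) h y : Fin (T + 1) → Ω) :=
  measurable_map_kernel (hs.kernel T) (measurable_snoc T)

lemma lintegral_compose_succ (hs : IsMarkovStep step) (T : ℕ) {f : (Fin (T + 1) → Ω) → ℝ≥0∞}
    (hf : Measurable f) : ∫⁻ x, f x ∂compose step (T + 1) =
      ∫⁻ h, ∫⁻ y, f (Fin.snoc (α := fun _ => Ω) h y) ∂step T h ∂compose step T := by
  rw [compose, Measure.lintegral_bind (hs.measurable_map_snoc T).aemeasurable hf.aemeasurable]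
  refine lintegral_congr fun h => ?_
  rw [lintegral_map hf (measurable_snoc_left T h)]

lemma isProbabilityMeasure_compose (hs : IsMarkovStep step) (T : ℕ) :
    IsProbabilityMeasure (compose step T) := by
  induction T with
  | zero => rw [compose]; infer_instance
  | succ T ih =>
    refine ⟨?_⟩
    have := hs.lintegral_compose_succ T (f := 1) measurable_one
    have key : ∀ h, (step T h) univ = 1 := fun h => (hs.isProbabilityMeasure T h).measure_univ
    simpa [key] using this

lemma measurable_lintegral_snoc (hs : IsMarkovStep step) (T : ℕ)
    {f : (Fin (T + 1) → Ω) → ℝ≥0∞} (hf : Measurable f) :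
    Measurable fun h => ∫⁻ y, f (Fin.snoc (α := fun _ => Ω) h y) ∂step T h :=
  (hf.comp (measurable_snoc T)).lintegral_kernel_prod_right' (κ := hs.kernel T)

/-- A deterministic post-processing of every output. -/
lemma compose_map (hs : IsMarkovStep step) {step' : (t : ℕ) → (Fin t → Ω') → Measure Ω'}
    (hs' : IsMarkovStep step') {f : Ω → Ω'} (hf : Measurable f)
    (h : ∀ t h, (step t h).map f = step' t fun s => f (h s)) (T : ℕ) :
    (compose step T).map (fun h s => f (h s)) = compose step' T := by
  have hfm : ∀ T, Measurable fun (h : Fin T → Ω) s => f (h s) := fun T =>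
    measurable_pi_iff.2 fun i => hf.comp (measurable_pi_apply i)
  induction T with
  | zero =>
    rw [compose, compose, Measure.map_dirac' (hfm 0)]
    congr 1
    exact Subsingleton.elim _ _
  | succ T ih =>
    refine Measure.ext_of_lintegral _ fun F hF => ?_
    rw [lintegral_map hF (hfm _), hs.lintegral_compose_succ T (f := fun h => F fun s => f (h s)) (hF.comp (hfm _)),
      hs'.lintegral_compose_succ T hF, ← ih,
      lintegral_map (hs'.measurable_lintegral_snoc T hF) (hfm T)]
    refine lintegral_congr fun x => ?_
    rw [← h T x, lintegral_map (f := fun z => F (Fin.snoc (α := fun _ => Ω') (fun s => f (x s)) z))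
      (hF.comp (measurable_snoc_left T _)) hf]
    refine lintegral_congr fun y => ?_
    congr 1
    exact Fin.comp_snoc f x y

end IsMarkovStep

/-- Randomized post-processing of a transcript, round by round. -/
def transcriptKernel (κ : (t : ℕ) → Kernel ((Fin t → Ω) × Ω) Ω') :
    (T : ℕ) → Kernel (Fin T → Ω) (Fin T → Ω')
  | 0 => Kernel.const _ (Measure.dirac Fin.elim0)
  | T + 1 =>
    -- The kernel `κ T` sees the original history and the original last output; the processed
    -- history is never fed back.
    ((((transcriptKernel κ T).comap (fun p : (Fin T → Ω) × Ω => p.1) measurable_fst) ×ₖ κ T).map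
      (fun p => (Fin.snoc (α := fun _ => Ω') p.1 p.2 : Fin (T + 1) → Ω'))).comap
      (fun h : Fin (T + 1) → Ω => ((fun i : Fin T => h i.castSucc), h (Fin.last T)))
      ((measurable_init T).prodMk (measurable_pi_apply _))

instance isMarkovKernel_transcriptKernel (κ : (t : ℕ) → Kernel ((Fin t → Ω) × Ω) Ω')
    [∀ t, IsMarkovKernel (κ t)] (T : ℕ) : IsMarkovKernel (transcriptKernel κ T) := by
  induction T with
  | zero => rw [transcriptKernel]; infer_instance
  | succ T ih =>
    rw [transcriptKernel]
    have := Kernel.IsMarkovKernel.map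
      ((((transcriptKernel κ T).comap (fun p : (Fin T → Ω) × Ω => p.1) measurable_fst) ×ₖ κ T))
      (measurable_snoc (Ω := Ω') T)
    infer_instance

lemma transcriptKernel_succ_snoc (κ : (t : ℕ) → Kernel ((Fin t → Ω) × Ω) Ω')
    [∀ t, IsMarkovKernel (κ t)] (T : ℕ) (h : Fin T → Ω) (y : Ω) :
    transcriptKernel κ (T + 1) (Fin.snoc (α := fun _ => Ω) h y) =
      ((transcriptKernel κ T h).prod (κ T (h, y))).map
        (fun p => (Fin.snoc (α := fun _ => Ω') p.1 p.2 : Fin (T + 1) → Ω')) := by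
  rw [transcriptKernel, Kernel.comap_apply, Kernel.map_apply _ (measurable_snoc T),
    Kernel.prod_apply, Kernel.comap_apply]
  simp

lemma map_snoc_prod_pi (ρ : Measure Ω) [IsProbabilityMeasure ρ] (T : ℕ) :
    ((Measure.pi fun _ : Fin T => ρ).prod ρ).map
      (fun p => (Fin.snoc (α := fun _ => Ω) p.1 p.2 : Fin (T + 1) → Ω)) =
      Measure.pi fun _ : Fin (T + 1) => ρ := by
  refine (Measure.pi_eq fun s hs => ?_).symm
  rw [Measure.map_apply (measurable_snoc T) (MeasurableSet.univ_pi hs)]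
  have : (fun p : (Fin T → Ω) × Ω => (Fin.snoc (α := fun _ => Ω) p.1 p.2 : Fin (T + 1) → Ω)) ⁻¹'
      univ.pi s = (univ.pi fun i : Fin T => s i.castSucc) ×ˢ s (Fin.last T) := by
    ext p
    simp [Fin.forall_fin_succ', Set.mem_pi]
  rw [this, Measure.prod_prod, Measure.pi_pi, Fin.prod_univ_castSucc]

/-- If the post-processing turns each round, whatever the history, into `ρ`, then it turns the
composition into `ρ^{⊗T}`. -/
lemma compose_bind_transcriptKernel {step : (t : ℕ) → (Fin t → Ω) → Measure Ω}
    (hs : IsMarkovStep step) (κ : (t : ℕ) → Kernel ((Fin t → Ω) × Ω) Ω')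
    [∀ t, IsMarkovKernel (κ t)] (ρ : Measure Ω') [IsProbabilityMeasure ρ]
    (h : ∀ t h, (step t h).bind (fun y => κ t (h, y)) = ρ) (T : ℕ) :
    (compose step T).bind (transcriptKernel κ T) = Measure.pi fun _ : Fin T => ρ := by
  induction T with
  | zero =>
    rw [compose, transcriptKernel, Measure.dirac_bind (Kernel.measurable _), Kernel.const_apply,
      Measure.pi_of_empty]
    congr 1
  | succ T ih =>
    refine Measure.ext_of_lintegral _ fun F hF => ?_
    have hG : Measurable fun p : (Fin T → Ω') × Ω' => F (Fin.snoc (α := fun _ => Ω') p.1 p.2) :=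
      hF.comp (measurable_snoc T)
    have hG2 : Measurable fun w : Fin T → Ω' => ∫⁻ z, F (Fin.snoc (α := fun _ => Ω') w z) ∂ρ :=
      hG.lintegral_prod_right'
    rw [Measure.lintegral_bind (Kernel.aemeasurable _) hF.aemeasurable,
      hs.lintegral_compose_succ T (hF.lintegral_kernel),
      ← map_snoc_prod_pi, lintegral_map hF (measurable_snoc T),
      lintegral_prod _ hG.aemeasurable, ← ih,
      Measure.lintegral_bind (Kernel.aemeasurable _) hG2.aemeasurable]
    refine lintegral_congr fun x => ?_
    have hκ : Measurable fun y => κ T (x, y) := (κ T).measurable.comp measurable_prodMk_left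
    have hG3 : Measurable fun z => ∫⁻ w, F (Fin.snoc (α := fun _ => Ω') w z)
        ∂(transcriptKernel κ T x) := hG.lintegral_prod_left'
    -- With the original history `x` fixed, the processed past depends on `x` alone, so its integral
    -- goes innermost. The integrals over `y` and `z` then merge into one over `ρ` by `h`, and a
    -- swap restores the order.
    calc ∫⁻ y, ∫⁻ w, F w ∂(transcriptKernel κ (T + 1) (Fin.snoc (α := fun _ => Ω) x y)) ∂step T x
        = ∫⁻ y, ∫⁻ z, ∫⁻ w, F (Fin.snoc (α := fun _ => Ω') w z) ∂(transcriptKernel κ T x)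
            ∂(κ T (x, y)) ∂step T x := by
          refine lintegral_congr fun y => ?_
          rw [transcriptKernel_succ_snoc, lintegral_map hF (measurable_snoc T),
            lintegral_prod_symm _ hG.aemeasurable]
      _ = ∫⁻ z, ∫⁻ w, F (Fin.snoc (α := fun _ => Ω') w z) ∂(transcriptKernel κ T x) ∂ρ := by
          rw [← h T x, Measure.lintegral_bind hκ.aemeasurable hG3.aemeasurable]
      _ = _ := lintegral_lintegral_swap (hG.comp measurable_swap).aemeasurable

end Compose

/-! ### Removing the mean difference by a Householder reflection -/

section Householder

variable {k : ℕ}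

/-- The normal vector of the hyperplane reflection that sends `d` to `‖d‖ • e₀`. -/
def householderNormal (d : E (k + 1)) : E (k + 1) := d - ‖d‖ • EuclideanSpace.single 0 1

/-- The hyperplane reflection that sends `d` to `‖d‖ • e₀`. -/
def householder (d x : E (k + 1)) : E (k + 1) :=
  x - (2 * (inner ℝ (householderNormal d) x / ‖householderNormal d‖ ^ 2)) • householderNormal d

/-- Isometry and linearity are read off from the reflection; the explicit formula serves joint
measurability in `d` and `x`, as `d` varies with the history. If the normal vanishes, both sides are
the identity. -/
lemma householder_eq_reflection (d x : E (k + 1)) :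
    householder d x = (ℝ ∙ householderNormal d)ᗮ.reflection x := by
  rw [Submodule.reflection_orthogonal_apply, Submodule.reflection_singleton_apply, householder]
  simp only [RCLike.ofReal_real_eq_id, id, two_smul, neg_sub]
  rw [two_mul, add_smul]

lemma householder_self (d : E (k + 1)) :
    householder d d = ‖d‖ • EuclideanSpace.single 0 1 := by
  rw [householder_eq_reflection]
  exact Submodule.reflection_sub (by simp [norm_smul])

lemma householder_self_succ (d : E (k + 1)) (j : Fin k) : householder d d j.succ = 0 := by
  simp [householder_self]

/-- A shift along `d` is visible only in the zeroth coordinate after the reflection. -/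
lemma householder_linear (d x : E (k + 1)) (s r : ℝ) (j : Fin k) :
    householder d (s • x + r • d) j.succ = s * householder d x j.succ := by
  have : householder d (s • x + r • d) = s • householder d x + r • householder d d := by
    simp only [householder_eq_reflection, map_add, map_smul]
  rw [this]
  simp [householder_self_succ]

lemma measurable_householder :
    Measurable fun p : E (k + 1) × E (k + 1) => householder p.1 p.2 := by
  unfold householder householderNormal
  fun_prop

end Householder

/-! ### The Gaussian laws after post-processing -/

section Gaussian

variable {k : ℕ}

/-- The standard Gaussian measure on `ℝᵏ`, as a product measure. -/
abbrev stdPi (k : ℕ) : Measure (Fin k → ℝ) := Measure.pi fun _ => gaussianReal 0 1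

lemma gaussianReal_prod_map (b c : ℝ) :
    ((gaussianReal 0 1).prod (gaussianReal 0 1)).map (fun z => b * z.1 + c * z.2) =
      gaussianReal 0 (b ^ 2 + c ^ 2).toNNReal := by
  have e : (fun z : ℝ × ℝ => b * z.1 + c * z.2) =
      (fun z : ℝ × ℝ => z.1 + z.2) ∘ Prod.map (b * ·) (c * ·) := rfl
  rw [e, ← Measure.map_map (by fun_prop) (by fun_prop),
    ← Measure.map_prod_map _ _ (by fun_prop) (by fun_prop), gaussianReal_map_const_mul,
    gaussianReal_map_const_mul]
  refine gaussianReal_conv_gaussianReal.trans ?_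
  congr 1
  · simp
  · ext
    rw [Real.coe_toNNReal _ (by positivity)]
    simp

lemma stdPi_prod_map (b c : ℝ) :
    ((stdPi k).prod (stdPi k)).map (fun z j => b * z.1 j + c * z.2 j) =
      Measure.pi fun _ : Fin k => gaussianReal 0 (b ^ 2 + c ^ 2).toNNReal := by
  rw [← (measurePreserving_arrowProdEquivProdArrow ℝ ℝ (Fin k) (fun _ => gaussianReal 0 1)
    (fun _ => gaussianReal 0 1)).map_eq, Measure.map_map (by fun_prop) (MeasurableEquiv.measurable _)]
  simp_rw [← gaussianReal_prod_map b c]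
  rw [← Measure.pi_map_pi fun _ => (by fun_prop)]
  rfl

lemma stdGaussian_map_tail :
    (stdGaussian (E (k + 1))).map (fun x (j : Fin k) => x j.succ) = stdPi k := by
  rw [← map_pi_eq_stdGaussian, Measure.map_map (by fun_prop) (by fun_prop)]
  have h := (measurePreserving_piFinSuccAbove (fun _ : Fin (k + 1) => gaussianReal 0 1) 0).map_eq
  have h2 := congrArg (fun m => m.map Prod.snd) h
  rw [Measure.map_map (by fun_prop) (MeasurableEquiv.measurable _), Measure.map_snd_prod,
    measure_univ, one_smul] at h2
  refine Eq.trans ?_ h2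
  congr 1

lemma stdGaussian_map_householder (d : E (k + 1)) :
    (stdGaussian (E (k + 1))).map (householder d) = stdGaussian (E (k + 1)) := by
  rw [show householder d = (ℝ ∙ householderNormal d)ᗮ.reflection from
    funext (householder_eq_reflection d)]
  exact stdGaussian_map _

/-- Rotation invariance: the reflected Gaussian still has independent standard coordinates, and all
but the zeroth are kept. -/
lemma stdGaussian_map_householder_tail (d : E (k + 1)) :
    (stdGaussian (E (k + 1))).map (fun x (j : Fin k) => householder d x j.succ) = stdPi k := by
  have hm : Measurable (householder d) := measurable_householder.comp measurable_prodMk_left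
  rw [← stdGaussian_map_tail]
  conv_rhs => rw [← stdGaussian_map_householder d, Measure.map_map (by fun_prop) hm]
  rfl

lemma noise_eq_map (n : ℕ) {σ C : ℝ} :
    noise n σ C = (stdGaussian (E n)).map fun x => (σ * C) • x := by
  rw [← map_pi_eq_stdGaussian, noise, Measure.map_map (by fun_prop) (by fun_prop)]
  have : gaussianReal 0 (σ ^ 2 * C ^ 2).toNNReal = (gaussianReal 0 1).map (σ * C * ·) := by
    rw [gaussianReal_map_const_mul]
    congr 1
    · simp
    · ext
      rw [Real.coe_toNNReal _ (by positivity)]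
      simp [mul_pow]
  rw [this, ← Measure.pi_map_pi fun _ => (by fun_prop), Measure.map_map (by fun_prop) (by fun_prop)]
  rfl

instance (n : ℕ) (σ C : ℝ) : IsProbabilityMeasure (noise n σ C) := by
  rw [noise_eq_map]
  exact Measure.isProbabilityMeasure_map (by fun_prop)

/-- Post-processing of an output `y`: rescale, center, reflect, drop the direction of the mean
difference, and replace a part of the signal by fresh noise. -/
def postMap (τ c a : ℝ) (m d y : E (k + 1)) (w : Fin k → ℝ) : Fin k → ℝ := fun j =>
  a * householder d (τ⁻¹ • (c • y - m)) j.succ + √(1 - a ^ 2) * w j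

lemma measurable_postMap {τ c a : ℝ} {A : Type*} [MeasurableSpace A] {m d y : A → E (k + 1)}
    {w : A → Fin k → ℝ} (hm : Measurable m) (hd : Measurable d) (hy : Measurable y)
    (hw : Measurable w) : Measurable fun x => postMap τ c a (m x) (d x) (y x) (w x) := by
  have h : Measurable fun x => householder (d x) (τ⁻¹ • (c • y x - m x)) :=
    measurable_householder.comp (hd.prodMk (by fun_prop))
  unfold postMap
  fun_prop

lemma bind_map_eq_prod_map {A B Γ : Type*} [MeasurableSpace A] [MeasurableSpace B]
    [MeasurableSpace Γ] (μ : Measure A) (ν : Measure B) [SFinite ν] {F : A × B → Γ}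
    (hF : Measurable F) : μ.bind (fun x => ν.map fun y => F (x, y)) = (μ.prod ν).map F := by
  have hm : Measurable fun x => ν.map fun y => F (x, y) := by
    have := (Measure.measurable_map F hF).comp (Measurable.map_prodMk_left (α := A) (ν := ν))
    convert this using 2 with x
    exact (Measure.map_map hF measurable_prodMk_left).symm
  refine Measure.ext_of_lintegral _ fun f hf => ?_
  rw [Measure.lintegral_bind hm.aemeasurable hf.aemeasurable, lintegral_map hf hF,
    lintegral_prod (fun z => f (F z)) (hf.comp hF).aemeasurable]
  refine lintegral_congr fun x => ?_
  exact lintegral_map hf (hF.comp measurable_prodMk_left)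

/-- The law of the post-processed output. -/
lemma output_bind_postMap {σ C c₀ c a r : ℝ} (hτ : σ * C ≠ 0) (ha : a ∈ Icc (0 : ℝ) 1)
    {m₀ m d : E (k + 1)} (hd : (c₀ * c⁻¹) • m - m₀ = (σ * C * r) • d) :
    ((noise (k + 1) σ C).map fun G => c⁻¹ • (m + G)).bind
        (fun y => (stdPi k).map (postMap (σ * C) c₀ a m₀ d y)) =
      Measure.pi fun _ : Fin k =>
        gaussianReal 0 (a ^ 2 * (c₀ * c⁻¹) ^ 2 + (1 - a ^ 2)).toNNReal := by
  have hF : Measurable fun p : E (k + 1) × (Fin k → ℝ) => postMap (σ * C) c₀ a m₀ d p.1 p.2 :=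
    measurable_postMap measurable_const measurable_const measurable_fst measurable_snd
  have hm : Measurable (householder d) := measurable_householder.comp measurable_prodMk_left
  refine (bind_map_eq_prod_map _ _ hF).trans ?_
  rw [noise_eq_map, Measure.map_map (by fun_prop) (by fun_prop)]
  have e0 : (stdPi k) = (stdPi k).map id := Measure.map_id.symm
  rw [e0, Measure.map_prod_map _ _ (by fun_prop) (by fun_prop),
    Measure.map_map hF (by fun_prop)]
  -- The signal, of standard deviation `c₀ / c` up to sign, is scaled by `a`; the fresh noise has
  -- variance `1 - a²`, so a unit-variance signal keeps unit variance.
  have hsq : (a * (c₀ * c⁻¹)) ^ 2 + √(1 - a ^ 2) ^ 2 = a ^ 2 * (c₀ * c⁻¹) ^ 2 + (1 - a ^ 2) := by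
    rw [Real.sq_sqrt (by nlinarith [ha.1, ha.2])]
    ring
  rw [← hsq, ← stdPi_prod_map]
  conv_rhs => enter [2, 1]; rw [← stdGaussian_map_householder_tail d]
  conv_rhs => enter [2, 2]; rw [e0]
  rw [Measure.map_prod_map _ _ (by fun_prop) (by fun_prop),
    Measure.map_map (by fun_prop) (by fun_prop)]
  congr 1
  ext1 ⟨x, w⟩
  ext1 j
  simp only [Function.comp, Prod.map, postMap, id]
  -- The whole mean is now a multiple of `d`, which the reflected tail ignores.
  have : (σ * C)⁻¹ • (c₀ • c⁻¹ • (m + (σ * C) • x) - m₀) = (c₀ * c⁻¹) • x + r • d := by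
    have h1 : c₀ • c⁻¹ • (m + (σ * C) • x) - m₀ =
        (σ * C) • ((c₀ * c⁻¹) • x) + ((c₀ * c⁻¹) • m - m₀) := by
      rw [smul_smul, smul_add, smul_comm (c₀ * c⁻¹)]
      abel
    rw [h1, hd, smul_add, inv_smul_smul₀ hτ, mul_smul (σ * C) r d, inv_smul_smul₀ hτ]
  rw [this, householder_linear]
  ring

end Gaussian

/-! ### Measurability and marginals of the rounds -/

section Rounds

variable {H Γ Γ' ι : Type*} [MeasurableSpace H] [MeasurableSpace Γ] [MeasurableSpace Γ']
  [MeasurableSpace ι] [Finite ι] [MeasurableSingletonClass ι]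

lemma lintegral_bind_finite (μ : Measure ι) (ρ : ι → Measure Γ) {f : Γ → ℝ≥0∞}
    (hf : Measurable f) : ∫⁻ x, f x ∂(μ.bind ρ) = ∫⁻ I, ∫⁻ x, f x ∂(ρ I) ∂μ :=
  Measure.lintegral_bind (measurable_of_finite ρ).aemeasurable hf.aemeasurable

lemma measurable_bind_finite (μ : Measure ι) {ρ : H → ι → Measure Γ}
    (hρ : ∀ I, Measurable fun h => ρ h I) : Measurable fun h => μ.bind (ρ h) := by
  have := Fintype.ofFinite ι
  refine Measure.measurable_of_measurable_coe _ fun s hs => ?_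
  have e : ∀ h, μ.bind (ρ h) s = ∑ I, ρ h I s * μ {I} := fun h => by
    rw [Measure.bind_apply hs (measurable_of_finite _).aemeasurable, lintegral_fintype]
  simp_rw [e]
  exact Finset.measurable_sum _ fun I _ =>
    ((Measure.measurable_coe hs).comp (hρ I)).mul_const _

lemma bind_map_finite (μ : Measure ι) (ρ : ι → Measure Γ) {f : Γ → Γ'} (hf : Measurable f) :
    (μ.bind ρ).map f = μ.bind fun I => (ρ I).map f := by
  refine Measure.ext_of_lintegral _ fun F hF => ?_
  rw [lintegral_map hF hf, lintegral_bind_finite _ _ (f := fun x => F (f x)) (hF.comp hf),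
    lintegral_bind_finite _ _ hF]
  exact lintegral_congr fun I => (lintegral_map hF hf).symm

lemma map_bind_finite {ι' : Type*} [MeasurableSpace ι'] [Finite ι'] [MeasurableSingletonClass ι']
    (μ : Measure ι) (r : ι → ι') (ρ : ι' → Measure Γ) :
    (μ.map r).bind ρ = μ.bind fun I => ρ (r I) := by
  refine Measure.ext_of_lintegral _ fun F hF => ?_
  rw [lintegral_bind_finite _ _ hF, lintegral_bind_finite _ _ hF,
    lintegral_map (measurable_of_finite _) (measurable_of_finite r)]

lemma bind_pair_bind (μ : Measure ι) (ρ : ι → Measure Γ) {κ : Γ × ι → Measure Γ'}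
    (hκ : Measurable κ) : (μ.bind fun I => (ρ I).map fun y => (y, I)).bind κ =
      μ.bind fun I => (ρ I).bind fun y => κ (y, I) := by
  refine Measure.ext_of_lintegral _ fun F hF => ?_
  have h1 : Measurable fun z => ∫⁻ x, F x ∂(κ z) := (Measure.measurable_lintegral hF).comp hκ
  rw [Measure.lintegral_bind hκ.aemeasurable hF.aemeasurable, lintegral_bind_finite _ _ h1,
    lintegral_bind_finite _ _ hF]
  refine lintegral_congr fun I => ?_
  rw [lintegral_map h1 (measurable_prodMk_right)]
  exact (Measure.lintegral_bind (hκ.comp measurable_prodMk_right).aemeasurable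
    hF.aemeasurable).symm

/-- The law of one selection bit. -/
abbrev coin (q : ℝ) : Measure Bool :=
  ENNReal.ofReal q • Measure.dirac true + ENNReal.ofReal (1 - q) • Measure.dirac false

variable {q : ℝ}

lemma isProbabilityMeasure_coin (hq0 : 0 ≤ q) (hq1 : q ≤ 1) : IsProbabilityMeasure (coin q) := by
  refine ⟨?_⟩
  simp only [Measure.coe_add, Measure.coe_smul, Pi.add_apply, Pi.smul_apply, measure_univ,
    smul_eq_mul, mul_one]
  rw [← ENNReal.ofReal_add hq0 (by linarith)]
  simp

lemma isProbabilityMeasure_batchLaw (hq0 : 0 ≤ q) (hq1 : q ≤ 1) (m : ℕ) :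
    IsProbabilityMeasure (batchLaw q m) := by
  have := isProbabilityMeasure_coin hq0 hq1
  unfold batchLaw
  infer_instance

/-- The unused bit integrates out, so the index of the larger dataset also drives the rounds on `D`.
-/
lemma batchLaw_map_castSucc (hq0 : 0 ≤ q) (hq1 : q ≤ 1) (N : ℕ) :
    (batchLaw q (N + 1)).map (fun I i => I (Fin.castSucc i)) = batchLaw q N := by
  have := isProbabilityMeasure_coin hq0 hq1
  change (Measure.pi fun _ : Fin (N + 1) => coin q).map _ = Measure.pi fun _ : Fin N => coin q
  rw [← map_snoc_prod_pi, Measure.map_map (measurable_of_finite _) (measurable_snoc _)]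
  have e : (fun (I : Fin (N + 1) → Bool) i => I (Fin.castSucc i)) ∘
      (fun p : (Fin N → Bool) × Bool => Fin.snoc (α := fun _ => Bool) p.1 p.2) = Prod.fst := by
    ext p i
    simp
  rw [e, Measure.map_fst_prod, measure_univ, one_smul]

variable {n m : ℕ} {σ C : ℝ} (v : Variant)

lemma measurable_clip {G : H → E n} (hG : Measurable G) : Measurable fun h => clip C (G h) := by
  unfold clip
  fun_prop

lemma measurable_sum_clip {G : H → Fin m → E n} (hG : ∀ i, Measurable fun h => G h i)
    (s : Finset (Fin m)) : Measurable fun h => ∑ i ∈ s, clip C (G h i) :=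
  Finset.measurable_sum _ fun i _ => measurable_clip (hG i)

lemma measurable_outputLaw {G : H → Fin m → E n} (hG : ∀ i, Measurable fun h => G h i)
    (S : Fin m → Bool) : Measurable fun h => outputLaw v q σ C (G h) S := by
  refine measurable_map_kernel (Kernel.const H (noise n σ C)) (F := fun p =>
    (v.factor q m (batchSize S))⁻¹ •
      ((∑ i ∈ Finset.univ.filter (fun i => S i = true), clip C (G p.1 i)) + p.2)) ?_
  have : Measurable fun p : H × E n =>
      ∑ i ∈ Finset.univ.filter (fun i => S i = true), clip C (G p.1 i) :=
    (measurable_sum_clip hG _).comp measurable_fst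
  fun_prop

lemma isProbabilityMeasure_outputLaw (g : Fin m → E n) (S : Fin m → Bool) :
    IsProbabilityMeasure (outputLaw v q σ C g S) :=
  Measure.isProbabilityMeasure_map (by fun_prop)

lemma isProbabilityMeasure_bind_finite {μ : Measure ι} [IsProbabilityMeasure μ]
    {ρ : ι → Measure Γ} (h : ∀ I, IsProbabilityMeasure (ρ I)) :
    IsProbabilityMeasure (μ.bind ρ) :=
  isProbabilityMeasure_bind (measurable_of_finite ρ).aemeasurable (ae_of_all _ h)

variable {Ω : Type*} [MeasurableSpace Ω] {N : ℕ}

lemma isMarkovStep_hidden (hq0 : 0 ≤ q) (hq1 : q ≤ 1)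
    {G : (t : ℕ) → (Fin t → E n) → Fin m → E n} (hG : ∀ t i, Measurable fun h => G t h i) :
    IsMarkovStep fun t h => hiddenRound v q σ C (G t h) where
  measurable t := measurable_bind_finite _ fun S => measurable_outputLaw v (hG t) S
  isProbabilityMeasure _ _ :=
    have := isProbabilityMeasure_batchLaw hq0 hq1 m
    isProbabilityMeasure_bind_finite fun S => isProbabilityMeasure_outputLaw v _ S

lemma isMarkovStep_transparent (hq0 : 0 ≤ q) (hq1 : q ≤ 1)
    {G : (t : ℕ) → (Fin t → E n × (Fin N → Bool)) → Fin m → E n}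
    (hG : ∀ t i, Measurable fun h => G t h i) (r : (Fin N → Bool) → Fin m → Bool) :
    IsMarkovStep fun t h => (batchLaw q N).bind fun I =>
      (outputLaw v q σ C (G t h) (r I)).map fun y => (y, I) where
  measurable t := measurable_bind_finite _ fun I =>
    (Measure.measurable_map _ measurable_prodMk_right).comp (measurable_outputLaw v (hG t) (r I))
  isProbabilityMeasure t h :=
    have := isProbabilityMeasure_batchLaw hq0 hq1 N
    isProbabilityMeasure_bind_finite fun I =>
      have := isProbabilityMeasure_outputLaw (q := q) (σ := σ) (C := C) v (G t h) (r I)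
      Measure.isProbabilityMeasure_map measurable_prodMk_right.aemeasurable

lemma isMarkovStep_large (hq0 : 0 ≤ q) (hq1 : q ≤ 1)
    {G : (t : ℕ) → (Fin t → E n × (Fin (N + 1) → Bool)) → Fin (N + 1) → E n}
    (hG : ∀ t i, Measurable fun h => G t h i) :
    IsMarkovStep fun t h => transparentRoundLarge v q σ C (G t h) :=
  isMarkovStep_transparent v hq0 hq1 hG id

lemma isMarkovStep_small (hq0 : 0 ≤ q) (hq1 : q ≤ 1)
    {G : (t : ℕ) → (Fin t → E n × (Fin (N + 1) → Bool)) → Fin N → E n}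
    (hG : ∀ t i, Measurable fun h => G t h i) :
    IsMarkovStep fun t h => transparentRoundSmall v q σ C (G t h) :=
  isMarkovStep_transparent v hq0 hq1 hG fun I i => I i.castSucc

lemma transparentRoundLarge_map_fst (g : Fin (N + 1) → E n) :
    (transparentRoundLarge v q σ C g).map Prod.fst = hiddenRound v q σ C g := by
  rw [transparentRoundLarge, bind_map_finite _ _ measurable_fst, hiddenRound]
  congr 1
  ext1 I
  rw [Measure.map_map measurable_fst measurable_prodMk_right]
  exact Measure.map_id

lemma transparentRoundSmall_map_fst (hq0 : 0 ≤ q) (hq1 : q ≤ 1) (g : Fin N → E n) :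
    (transparentRoundSmall v q σ C g).map Prod.fst = hiddenRound v q σ C g := by
  rw [transparentRoundSmall, bind_map_finite _ _ measurable_fst, hiddenRound,
    ← batchLaw_map_castSucc hq0 hq1 N, map_bind_finite]
  congr 1
  ext1 I
  rw [Measure.map_map measurable_fst measurable_prodMk_right]
  exact Measure.map_id

/-- Hiding the indices is a post-processing. -/
lemma tradeOff_transparent_le_hidden {X : Type*} (hq0 : 0 ≤ q) (hq1 : q ≤ 1)
    (g : Info X n) (hg : ∀ t x, Measurable fun h => g t h x)
    (D : Fin N → X) (D' : Fin (N + 1) → X) (T : ℕ) {α : ℝ} (hα : 0 ≤ α) :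
    tradeOff (transparentCompSmall v q σ C g D T) (transparentCompLarge v q σ C g D' T) α ≤
      tradeOff (hiddenComp v q σ C g D T) (hiddenComp v q σ C g D' T) α := by
  have hfst : ∀ t, Measurable fun (h : Fin t → E n × (Fin (N + 1) → Bool)) s => (h s).1 :=
    fun t => measurable_pi_iff.2 fun i => measurable_fst.comp (measurable_pi_apply i)
  have hL := isMarkovStep_large (σ := σ) (C := C) v hq0 hq1
    (G := fun t h i => g t (fun s => (h s).1) (D' i)) fun t i => (hg t (D' i)).comp (hfst t)
  have hS := isMarkovStep_small (σ := σ) (C := C) v hq0 hq1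
    (G := fun t (h : Fin t → E n × (Fin (N + 1) → Bool)) i => g t (fun s => (h s).1) (D i))
    fun t i => (hg t (D i)).comp (hfst t)
  have eL := hL.compose_map (isMarkovStep_hidden (σ := σ) (C := C) v hq0 hq1
    (G := fun t h i => g t h (D' i)) fun t i => hg t (D' i)) measurable_fst
    (fun t h => transparentRoundLarge_map_fst v _) T
  have eS := hS.compose_map (isMarkovStep_hidden (σ := σ) (C := C) v hq0 hq1
    (G := fun t h i => g t h (D i)) fun t i => hg t (D i)) measurable_fst
    (fun t h => transparentRoundSmall_map_fst v hq0 hq1 _) T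
  have : IsProbabilityMeasure (transparentCompLarge v q σ C g D' T) :=
    hL.isProbabilityMeasure_compose T
  rw [hiddenComp, hiddenComp, ← eL, ← eS]
  exact tradeOff_le_map (transparentCompSmall v q σ C g D T) _ (hfst T) hα

end Rounds

/-! ### The per-round upper bound as a post-processing -/

section UpperBound

variable {k N : ℕ} {q σ C : ℝ} (v : Variant)

lemma orOne_ne_zero (x : ℝ) : orOne x ≠ 0 := by
  unfold orOne
  split_ifs with h
  · exact one_ne_zero
  · exact h

lemma orOne_of_ne_zero {x : ℝ} (h : x ≠ 0) : orOne x = x := by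
  unfold orOne
  rw [if_neg h]

lemma factor_ne_zero (q : ℝ) (m k : ℕ) : v.factor q m k ≠ 0 := by
  cases v <;> exact orOne_ne_zero _

/-- The ratio of the normalization factors of the two datasets, given the index. -/
def factorRatio (q : ℝ) (I : Fin (N + 1) → Bool) : ℝ :=
  v.factor q N (batchSize fun i : Fin N => I i.castSucc) * (v.factor q (N + 1) (batchSize I))⁻¹

/-- The law of the post-processed round on the larger dataset, given the index, if the signal is
attenuated by the factor `a`. -/
def attenuatedLaw (k : ℕ) (q a : ℝ) (I : Fin (N + 1) → Bool) : Measure (Fin k → ℝ) :=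
  Measure.pi fun _ : Fin k =>
    gaussianReal 0 (a ^ 2 * factorRatio v q I ^ 2 + (1 - a ^ 2)).toNNReal

instance (q a : ℝ) (I : Fin (N + 1) → Bool) :
    IsProbabilityMeasure (attenuatedLaw v k q a I) := by
  unfold attenuatedLaw
  infer_instance

lemma bind_const_of_isProbabilityMeasure {A B : Type*} [MeasurableSpace A] [MeasurableSpace B]
    (μ : Measure A) [IsProbabilityMeasure μ] (ν : Measure B) : μ.bind (fun _ => ν) = ν := by
  rw [Measure.bind_const, measure_univ, one_smul]

/-- One round on either dataset can be post-processed, knowing the history, to centered Gaussians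
in one dimension less. -/
lemma exists_postKernel {H : Type*} [MeasurableSpace H] (hq0 : 0 ≤ q) (hq1 : q ≤ 1)
    (hτ : σ * C ≠ 0) {A : (Fin (N + 1) → Bool) → ℝ} (hA : ∀ I, A I ∈ Icc (0 : ℝ) 1)
    {G : H → Fin (N + 1) → E (k + 1)} (hG : ∀ i, Measurable fun h => G h i) :
    ∃ κ : Kernel (H × (E (k + 1) × (Fin (N + 1) → Bool))) (Fin k → ℝ), IsMarkovKernel κ ∧
      (∀ h, (transparentRoundSmall v q σ C fun i => G h (Fin.castSucc i)).bind
        (fun y => κ (h, y)) = stdPi k) ∧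
      ∀ h, (transparentRoundLarge v q σ C (G h)).bind (fun y => κ (h, y)) =
        (batchLaw q (N + 1)).bind fun I => attenuatedLaw v k q (A I) I := by
  have := isProbabilityMeasure_batchLaw hq0 hq1 (N + 1)
  set c : (Fin (N + 1) → Bool) → ℝ := fun I =>
    v.factor q N (batchSize fun i : Fin N => I i.castSucc) with hc
  set m₀ : (Fin (N + 1) → Bool) → H → E (k + 1) := fun I h =>
    ∑ i ∈ Finset.univ.filter (fun i : Fin N => I i.castSucc = true), clip C (G h i.castSucc) with hm₀
  set m₁ : (Fin (N + 1) → Bool) → H → E (k + 1) := fun I h =>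
    ∑ i ∈ Finset.univ.filter (fun i => I i = true), clip C (G h i) with hm₁
  -- The mean that is left on `D'` after normalizing as on `D`, centering and rescaling: the
  -- direction to be removed.
  set d : (Fin (N + 1) → Bool) → H → E (k + 1) := fun I h =>
    (σ * C)⁻¹ • (factorRatio v q I • m₁ I h - m₀ I h) with hd
  have hm₀m : ∀ I, Measurable (m₀ I) := fun I => measurable_sum_clip (fun i => hG i.castSucc) _
  have hm₁m : ∀ I, Measurable (m₁ I) := fun I => measurable_sum_clip hG _
  have hdm : ∀ I, Measurable (d I) := fun I =>
    (((hm₁m I).const_smul (factorRatio v q I)).sub (hm₀m I)).const_smul (σ * C)⁻¹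
  set F : (H × (E (k + 1) × (Fin (N + 1) → Bool))) × (Fin k → ℝ) → Fin k → ℝ := fun p =>
    postMap (σ * C) (c p.1.2.2) (A p.1.2.2) (m₀ p.1.2.2 p.1.1) (d p.1.2.2 p.1.1) p.1.2.1 p.2
    with hF
  have hFm : Measurable F := by
    -- The index has finitely many values, so joint measurability is checked for each fixed index.
    have h1 : Measurable fun p : (H × E (k + 1) × (Fin k → ℝ)) × (Fin (N + 1) → Bool) =>
        postMap (σ * C) (c p.2) (A p.2) (m₀ p.2 p.1.1) (d p.2 p.1.1) p.1.2.1 p.1.2.2 :=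
      measurable_from_prod_countable_left fun I =>
        measurable_postMap (τ := σ * C) (c := c I) (a := A I)
          (A := H × E (k + 1) × (Fin k → ℝ)) (y := fun p => p.2.1)
          (w := fun p => p.2.2) ((hm₀m I).comp measurable_fst) ((hdm I).comp measurable_fst)
          (by fun_prop) (by fun_prop)
    have h2 : Measurable fun p : (H × (E (k + 1) × (Fin (N + 1) → Bool))) × (Fin k → ℝ) =>
        ((p.1.1, p.1.2.1, p.2), p.1.2.2) := by fun_prop
    exact h1.comp h2
  let κ : Kernel (H × (E (k + 1) × (Fin (N + 1) → Bool))) (Fin k → ℝ) :=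
    ⟨fun a => (stdPi k).map fun w => F (a, w), measurable_map_kernel (Kernel.const _ (stdPi k)) hFm⟩
  have hκ : ∀ h, Measurable fun y => κ (h, y) := fun h =>
    κ.measurable.comp measurable_prodMk_left
  refine ⟨κ, ⟨fun a => Measure.isProbabilityMeasure_map
    (hFm.comp measurable_prodMk_left).aemeasurable⟩, fun h => ?_, fun h => ?_⟩
  · rw [transparentRoundSmall, bind_pair_bind _ _ (hκ h)]
    refine Eq.trans ?_ (bind_const_of_isProbabilityMeasure (batchLaw q (N + 1)) (stdPi k))
    congr 1
    ext1 I
    have hcI : c I ≠ 0 := factor_ne_zero v _ _ _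
    -- On `D` the centering is exact, hence `r = 0`, and the factor ratio is `1`, so the attenuation
    -- has no effect on the law.
    refine (output_bind_postMap (r := 0) (c₀ := c I) (c := c I) (d := d I h) hτ (hA I) (m₀ := m₀ I h)
      (m := m₀ I h) ?_).trans ?_
    · rw [mul_inv_cancel₀ hcI]
      simp
    · rw [mul_inv_cancel₀ hcI]
      simp
  · rw [transparentRoundLarge, bind_pair_bind _ _ (hκ h)]
    congr 1
    ext1 I
    refine output_bind_postMap (r := 1) (c₀ := c I) (c := v.factor q (N + 1) (batchSize I))
      (d := d I h) hτ (hA I) (m₀ := m₀ I h) (m := m₁ I h) ?_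
    rw [mul_one, hd, smul_inv_smul₀ hτ]
    rfl

lemma batchSize_succ (I : Fin (N + 1) → Bool) :
    batchSize I = batchSize (fun i : Fin N => I i.castSucc) + if I (Fin.last N) then 1 else 0 := by
  simp only [batchSize, Finset.card_filter]
  rw [Fin.sum_univ_castSucc]

/-- The per-round bounds compare the laws `N(0, 1)` and `Q_x`. -/
abbrev ratioPi (k x : ℕ) : Measure (Fin k → ℝ) :=
  Measure.pi fun _ : Fin k => gaussianReal 0 (((x : ℝ≥0) / ((x : ℝ≥0) + 1)) ^ 2)

lemma attenuatedLaw_eq_ratioPi {q a : ℝ} {I : Fin (N + 1) → Bool} {x : ℕ}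
    (h : a ^ 2 * factorRatio v q I ^ 2 + (1 - a ^ 2) = ((x : ℝ) / (x + 1)) ^ 2) :
    attenuatedLaw v k q a I = ratioPi k x := by
  unfold attenuatedLaw
  rw [h]
  congr 1
  ext1 _
  congr 1
  ext
  rw [Real.coe_toNNReal _ (by positivity)]
  simp

lemma represents_ratio (k x : ℕ) : Represents (gaussTradeOff k x) (stdPi k) (ratioPi k x) :=
  ⟨inferInstance, inferInstance, fun _ _ => rfl⟩

/-- The extra point is selected, and not alone. -/
def IsActive (I : Fin (N + 1) → Bool) : Prop :=
  I (Fin.last N) = true ∧ batchSize (fun i : Fin N => I i.castSucc) ≠ 0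

/-- From the event that the extra point is selected, of probability `q`, remove the event that it is
selected alone, of probability `q (1 - q)^N`. -/
lemma batchLaw_active (hq0 : 0 ≤ q) (hq1 : q ≤ 1) (N : ℕ) :
    batchLaw q (N + 1) {I | IsActive I} = ENNReal.ofReal (q - q * (1 - q) ^ N) := by
  have := isProbabilityMeasure_coin hq0 hq1
  have := isProbabilityMeasure_batchLaw hq0 hq1 (N + 1)
  have ht : coin q {true} = ENNReal.ofReal q := by simp [coin]
  have hf : coin q {false} = ENNReal.ofReal (1 - q) := by simp [coin]
  set U : Set (Fin (N + 1) → Bool) :=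
    univ.pi (Fin.snoc (α := fun _ => Set Bool) (fun _ => univ) {true}) with hU
  set W : Set (Fin (N + 1) → Bool) :=
    univ.pi (Fin.snoc (α := fun _ => Set Bool) (fun _ => {false}) {true}) with hW
  have eU : batchLaw q (N + 1) U = ENNReal.ofReal q := by
    change (Measure.pi fun _ => coin q) U = _
    rw [hU, Measure.pi_pi, Fin.prod_univ_castSucc]
    simp only [Fin.snoc_castSucc, Fin.snoc_last, measure_univ, Finset.prod_const_one, one_mul, ht]
  have eW : batchLaw q (N + 1) W = ENNReal.ofReal (q * (1 - q) ^ N) := by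
    change (Measure.pi fun _ => coin q) W = _
    rw [hW, Measure.pi_pi, Fin.prod_univ_castSucc]
    simp only [Fin.snoc_castSucc, Fin.snoc_last, ht, hf, Finset.prod_const, Finset.card_univ,
      Fintype.card_fin]
    rw [mul_comm, ENNReal.ofReal_mul hq0, ENNReal.ofReal_pow (by linarith)]
  have hWU : W ⊆ U := by
    refine pi_mono fun i _ => ?_
    refine Fin.lastCases ?_ (fun j => ?_) i <;> simp
  have e : {I : Fin (N + 1) → Bool | IsActive I} = U \ W := by
    ext I
    simp only [hU, hW, IsActive, mem_sdiff, mem_ofPred_eq, mem_univ_pi, Fin.forall_fin_succ',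
      Fin.snoc_castSucc, Fin.snoc_last, mem_univ, mem_singleton_iff, batchSize, ne_eq,
      Finset.card_eq_zero, Finset.filter_eq_empty_iff, Finset.mem_univ, true_imp_iff,
      Bool.not_eq_true]
    tauto
  rw [e, measure_sdiff hWU (Set.toFinite W).measurableSet.nullMeasurableSet (measure_ne_top _ _),
    eU, eW, ENNReal.ofReal_sub _ (mul_nonneg hq0 (pow_nonneg (by linarith) _))]

lemma bind_ite {A B : Type*} [MeasurableSpace A] [Finite A] [MeasurableSingletonClass A]
    [MeasurableSpace B] (μ : Measure A) (s : A → Prop) [DecidablePred s] (Q P : Measure B) :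
    μ.bind (fun I => if s I then Q else P) = μ {I | s I} • Q + μ {I | ¬ s I} • P := by
  ext B hB
  have h1 : ∫⁻ I in {I | s I}, (if s I then Q else P) B ∂μ = ∫⁻ _ in {I | s I}, Q B ∂μ :=
    setLIntegral_congr_fun (Set.toFinite _).measurableSet fun I (hI : s I) => by simp [hI]
  have h2 : ∫⁻ I in {I | s I}ᶜ, (if s I then Q else P) B ∂μ = ∫⁻ _ in {I | s I}ᶜ, P B ∂μ :=
    setLIntegral_congr_fun (Set.toFinite _).measurableSet fun I (hI : ¬ s I) => by simp [hI]
  rw [Measure.bind_apply hB (measurable_of_finite _).aemeasurable,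
    ← lintegral_add_compl _ (Set.toFinite {I | s I}).measurableSet, h1, h2]
  simp [mul_comm]
  rfl

/-- The attenuation that turns the ratio `j / (j + 1)` into `N / (N + 1)`. -/
lemma exists_attenuation {s t : ℝ} (hs : 0 ≤ s) (hst : s ≤ t) (ht : t < 1) :
    ∃ a ∈ Icc (0 : ℝ) 1, a ^ 2 * s ^ 2 + (1 - a ^ 2) = t ^ 2 := by
  have h1 : 0 < 1 - s ^ 2 := by nlinarith
  have h2 : 0 ≤ 1 - t ^ 2 := by nlinarith
  -- The equation is linear in `a²`, and `s ≤ t < 1` places its solution in `[0, 1]`.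
  refine ⟨√((1 - t ^ 2) / (1 - s ^ 2)), ⟨Real.sqrt_nonneg _, ?_⟩, ?_⟩
  · rw [Real.sqrt_le_iff, one_pow, div_le_one h1]
    exact ⟨zero_le_one, by nlinarith⟩
  · rw [Real.sq_sqrt (by positivity)]
    field_simp
    ring

/-- The per-round upper bound is the trade-off function of a post-processed round. -/
lemma exists_attenuation_represents (hN : 1 ≤ N) (hq0 : 0 ≤ q) (hq1 : q ≤ 1)
    (hv : v.Regime q N) : ∃ A : (Fin (N + 1) → Bool) → ℝ, (∀ I, A I ∈ Icc (0 : ℝ) 1) ∧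
      Represents (v.fbar q N (k + 1)) (stdPi k)
        ((batchLaw q (N + 1)).bind fun I => attenuatedLaw v k q (A I) I) := by
  have := isProbabilityMeasure_batchLaw hq0 hq1 (N + 1)
  have hN' : (0 : ℝ) < N := by exact_mod_cast hN
  -- When the ratio is the same for every index, no attenuation is needed and averaging over the
  -- index changes nothing.
  have hconst : ∀ x : ℕ, (∀ I : Fin (N + 1) → Bool, factorRatio v q I = (x : ℝ) / (x + 1)) →
      ((batchLaw q (N + 1)).bind fun I => attenuatedLaw v k q 1 I) = ratioPi k x := by
    intro x hx
    refine Eq.trans ?_ (bind_const_of_isProbabilityMeasure (batchLaw q (N + 1)) (ratioPi k x))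
    congr 1
    ext1 I
    exact attenuatedLaw_eq_ratioPi v (by rw [hx I]; ring)
  cases v with
  | EASGM =>
    refine ⟨fun _ => 1, fun _ => by simp, ?_⟩
    have hq : (0 : ℝ) < q := hv
    rw [hconst N fun I => ?_]
    · exact represents_ratio k N
    · simp only [factorRatio, Variant.factor]
      rw [orOne_of_ne_zero (by positivity), orOne_of_ne_zero (by positivity)]
      push_cast
      field_simp
  | FEASGM =>
    obtain ⟨h1, h2⟩ := hv
    refine ⟨fun _ => 1, fun _ => by simp, ?_⟩
    rw [hconst ⌊(N : ℝ) * q⌋₊ fun I => ?_]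
    · exact represents_ratio k _
    · simp only [factorRatio, Variant.factor]
      rw [h2, orOne_of_ne_zero (by positivity), orOne_of_ne_zero (by positivity)]
      push_cast
      rfl
  | ASGM =>
    classical
    have hr : ∀ I : Fin (N + 1) → Bool, ∃ a ∈ Icc (0 : ℝ) 1,
        attenuatedLaw Variant.ASGM k q a I = if IsActive I then ratioPi k N else stdPi k := by
      intro I
      by_cases hI : IsActive I
      · obtain ⟨hb, hj⟩ := hI
        set j := batchSize fun i : Fin N => I i.castSucc with hjdef
        have hjN : j ≤ N := (Finset.card_filter_le _ _).trans (by simp)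
        have hjr : (0 : ℝ) < j := by exact_mod_cast Nat.pos_of_ne_zero hj
        have hjN' : (j : ℝ) ≤ N := by exact_mod_cast hjN
        have hratio : factorRatio Variant.ASGM q I = (j : ℝ) / (j + 1) := by
          simp only [factorRatio, Variant.factor]
          rw [batchSize_succ I, ← hjdef, hb, if_pos rfl, orOne_of_ne_zero (by positivity),
            orOne_of_ne_zero (by positivity)]
          push_cast
          rfl
        -- The ratio `j / (j + 1)` increases with `j`, so `j = N` is the value to which all active
        -- indices can be brought.
        obtain ⟨a, ha, e⟩ := exists_attenuation (s := (j : ℝ) / (j + 1)) (t := (N : ℝ) / (N + 1))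
          (by positivity) (by rw [div_le_div_iff₀ (by positivity) (by positivity)]; nlinarith)
          (by rw [div_lt_one (by positivity)]; linarith)
        refine ⟨a, ha, ?_⟩
        rw [if_pos ⟨hb, hj⟩]
        exact attenuatedLaw_eq_ratioPi _ (by rw [hratio]; exact e)
      -- For an inactive index the signal is discarded and replaced by fresh noise.
      · refine ⟨0, by simp, ?_⟩
        rw [if_neg hI]
        simp [attenuatedLaw]
    choose A hA hA' using hr
    refine ⟨A, hA, ?_⟩
    have hpow : (1 - q) ^ N ≤ 1 := pow_le_one₀ (by linarith) (by linarith)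
    have hpow0 : 0 ≤ (1 - q) ^ N := pow_nonneg (by linarith) N
    have hM : ((batchLaw q (N + 1)).bind fun I => attenuatedLaw Variant.ASGM k q (A I) I) =
        ENNReal.ofReal (q - q * (1 - q) ^ N) • ratioPi k N +
          ENNReal.ofReal (1 - (q - q * (1 - q) ^ N)) • stdPi k := by
      simp_rw [hA']
      rw [bind_ite]
      have hc : {I : Fin (N + 1) → Bool | ¬ IsActive I} = {I | IsActive I}ᶜ := rfl
      rw [hc, prob_compl_eq_one_sub (Set.toFinite _).measurableSet, batchLaw_active hq0 hq1,
        ENNReal.ofReal_sub 1 (by nlinarith), ENNReal.ofReal_one]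
    have hprob : IsProbabilityMeasure
        ((batchLaw q (N + 1)).bind fun I => attenuatedLaw Variant.ASGM k q (A I) I) :=
      isProbabilityMeasure_bind_finite fun I => inferInstance
    refine ⟨inferInstance, hprob, fun α hα => ?_⟩
    rw [tradeOff_mixture (stdPi k) (ratioPi k N) _ (by nlinarith) (by nlinarith) hM hα]
    change _ = (q - q * (1 - q) ^ N) * tradeOff (stdPi k) (ratioPi k N) α +
      (1 - q + q * (1 - q) ^ N) * (1 - α)
    ring

end UpperBound

end DPSGD

end

/-! ### The two comparisons for the composed mechanisms -/

theorem mainTheorem10 (v : DPSGD.Variant) {X : Type*} (n N : ℕ) (hn : 1 ≤ n) (hN : 1 ≤ N)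
    (q σ C : ℝ) (hq0 : 0 ≤ q) (hq1 : q ≤ 1) (hσ : 0 < σ) (hC : 0 < C)
    (g : DPSGD.Info X n) (hg : ∀ t x, Measurable fun h => g t h x)
    (D : Fin N → X) (D' : Fin (N + 1) → X) (hD : ∀ i : Fin N, D' i.castSucc = D i)
    (T : ℕ) (hT : 1 ≤ T) :
    (∀ α ∈ Set.Icc (0 : ℝ) 1,
      DPSGD.tradeOff (DPSGD.hiddenComp v q σ C g D T) (DPSGD.hiddenComp v q σ C g D' T) α ≥
        DPSGD.tradeOff (DPSGD.transparentCompSmall v q σ C g D T)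
          (DPSGD.transparentCompLarge v q σ C g D' T) α) ∧
    (v.Regime q N →
      DPSGD.TensorPowSpec (v.fbar q N n) T ∧
      ∀ α ∈ Set.Icc (0 : ℝ) 1,
        DPSGD.tensorPow (v.fbar q N n) T α ≥
          DPSGD.tradeOff (DPSGD.transparentCompSmall v q σ C g D T)
            (DPSGD.transparentCompLarge v q σ C g D' T) α) := by
  refine ⟨fun α hα => DPSGD.tradeOff_transparent_le_hidden v hq0 hq1 g hg D D' T hα.1,
    fun hv => ?_⟩
  -- One coordinate is spent on removing the mean difference; the remaining `k` give the exponent `n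
  -- - 1`.
  obtain ⟨k, rfl⟩ : ∃ k, n = k + 1 := ⟨n - 1, by omega⟩
  obtain ⟨A, hA, hrep⟩ := DPSGD.exists_attenuation_represents (k := k) v hN hq0 hq1 hv
  refine ⟨DPSGD.tensorPowSpec_of_represents hrep T, fun α hα => ?_⟩
  have hfst : ∀ t, Measurable fun (h : Fin t → DPSGD.E (k + 1) × (Fin (N + 1) → Bool)) s =>
      (h s).1 :=
    fun t => measurable_pi_iff.2 fun i => measurable_fst.comp (measurable_pi_apply i)
  have hG : ∀ t i, Measurable fun (h : Fin t → DPSGD.E (k + 1) × (Fin (N + 1) → Bool)) =>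
      g t (fun s => (h s).1) (D' i) := fun t i => (hg t (D' i)).comp (hfst t)
  have hκ := fun t => DPSGD.exists_postKernel v hq0 hq1 (mul_pos hσ hC).ne' hA (hG t)
  choose κ hκm hκS hκL using hκ
  have hL := DPSGD.isMarkovStep_large (σ := σ) (C := C) v hq0 hq1 hG
  have hS := DPSGD.isMarkovStep_small (σ := σ) (C := C) v hq0 hq1 fun t i => hG t (Fin.castSucc i)
  have hprob := hrep.2.1
  have eL := DPSGD.compose_bind_transcriptKernel hL κ _ hκL T
  have eS := DPSGD.compose_bind_transcriptKernel hS κ _ hκS T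
  have hLp : IsProbabilityMeasure (DPSGD.transparentCompLarge v q σ C g D' T) :=
    hL.isProbabilityMeasure_compose T
  have hSp := hS.isProbabilityMeasure_compose T
  -- The tensor power is realized by the processed transcripts; the same kernels `κ` act on both
  -- datasets, so data processing applies.
  rw [← DPSGD.tensorPow_eq hrep T hα, ← eL, ← eS]
  -- As `D` consists of the first `N` points of `D'`, the vectors of `D'` describe both transcripts.
  have eD : DPSGD.transparentCompSmall v q σ C g D T =
      DPSGD.compose (fun t h => DPSGD.transparentRoundSmall v q σ C fun i =>
        g t (fun s => (h s).1) (D' (Fin.castSucc i))) T := by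
    simp only [hD]
    rfl
  rw [eD]
  exact DPSGD.tradeOff_le_bind _ _ _ hα.1
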